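/- Let $K$ be a non-Archimedean local field with its normalized absolute value $|\cdot|$, let $O=\{x\in K:|x|\le 1\}$ be its ring of integers, $q$ the cardinality of the residue field (so that a generator of the maximal ideal of $O$ has absolute value $q^{-1}$), $dx$ the Haar measure on $(K,+)$ with $\int_O dx=1$, and $\chi$ a continuous additive character $K\to\{z\in\mathbb C:|z|=1\}$ of rank zero, i.e. $\chi=1$ on $O$ and $\chi(x_0)\ne 1$ for some $x_0$ with $|x_0|=q$. Let $\mathcal F f(\xi)=\int_K\chi(x\xi)f(x)\,dx$ and $\mathcal F^{-1}g(x)=\int_K\chi(-x\xi)g(\xi)\,d\xi$. Let $\mathcal D(O)$ be the space of locally constant functions $\varphi:K\to\mathbb C$ vanishing outside $O$. For $\varphi\in\mathcal D(O)$ put $D^1\varphi=\mathcal F^{-1}\big[|\xi|\,\mathcal F\varphi(\xi)\big]$ (Vladimirov's operator). Let $D_O^1$ be the closure in $L^2(O)$ of the operator with domain $\mathcal D(O)$ given by $\varphi\mapsto (D^1\varphi)|_O$. For a function $\varphi$ on $K$ put $$(D^{-1}\varphi)(x)=\frac{1-q}{q\log q}\int_K\log|x-y|\,\varphi(y)\,dy,\qquad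 (I^1\varphi)(x)=(D^{-1}\varphi)(x)-(D^{-1}\varphi)(0),$$ and for $u\in L^2(O)$ and $x\in O$ let $(I_O^1u)(x)=(I^1\tilde u)(x)$, where $\tilde u$ is the extension of $u$ to $K$ by zero. **Theorem 1.** The operator $\varphi\mapsto (D^1\varphi)|_O$ on $\mathcal D(O)$ is closable, and its closure $D_O^1$ is injective with range all of $L^2(O)$. For every $u\in L^2(O)$, the element $(D_O^1)^{-1}u$ of $L^2(O)$ has a continuous representative on $O$; and, with $(D_O^1)^{-1}u$ denoting such a representative, for every $x\in O$ the integral $\int_O\log|x-y|\,u(y)\,dy$ converges absolutely, and $$(I_O^1u)(x)=\frac{1-q}{q\log q}\int_{|y|\le|x|}\big(\log|x-y|-\log|y|\big)u(y)\,dy=\big((D_O^1)^{-1}u\big)(x)-\big((D_O^1)^{-1}u\big)(0).$$ -/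

import Mathlib

open MeasureTheory Metric

set_option linter.unusedSectionVars false

noncomputable section

namespace LocalFieldCalculus

/-- The unit ball `O = {x : |x| ≤ 1}` of `K`, as a subset of `K`. -/
abbrev unitBall (K : Type*) [NormedField K] : Set K := closedBall 0 1

section Field

variable (K : Type*) [NontriviallyNormedField K] [IsUltrametricDist K]

/-- The ring of integers `O = {x : |x| ≤ 1}`, as a (local) ring. -/
abbrev integers : ValuationSubring K := (NormedField.valuation (K := K)).valuationSubring

/-- The cardinality `q` of the residue field `O / P`. -/
def resCard : ℕ := Nat.card (IsLocalRing.ResidueField (integers K))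

/-- The absolute value of `K` is normalized: the maximal ideal `P` of `O` has a generator `β`
with `|β| = 1 / q`. -/
def IsNormalizedAbs : Prop :=
  ∃ β : integers K, IsLocalRing.maximalIdeal (integers K) = Ideal.span {β} ∧
    ‖(β : K)‖ = (resCard K : ℝ)⁻¹

/-- The test functions supported in `O`: the functions `K → ℂ` that are locally constant (with a
radius of constancy independent of the point) and vanish outside of `O`. -/
def testO : Submodule ℂ (K → ℂ) where
  carrier := {φ | (∃ δ : ℝ, 0 < δ ∧ ∀ x x' : K, ‖x'‖ ≤ δ → φ (x + x') = φ x) ∧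
    ∀ x ∉ unitBall K, φ x = 0}
  zero_mem' := ⟨⟨1, one_pos, fun _ _ _ => rfl⟩, fun _ _ => rfl⟩
  add_mem' := by
    rintro φ ψ ⟨⟨d, hd, h1⟩, h2⟩ ⟨⟨e, he, h3⟩, h4⟩
    refine ⟨⟨min d e, lt_min hd he, fun x x' hx => ?_⟩, fun x hx => ?_⟩
    · simp only [Pi.add_apply, h1 x x' (hx.trans (min_le_left _ _)),
        h3 x x' (hx.trans (min_le_right _ _))]
    · simp only [Pi.add_apply, h2 x hx, h4 x hx, add_zero]
  smul_mem' := by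
    rintro c φ ⟨⟨d, hd, h1⟩, h2⟩
    refine ⟨⟨d, hd, fun x x' hx => ?_⟩, fun x hx => ?_⟩
    · simp only [Pi.smul_apply, h1 x x' hx]
    · simp only [Pi.smul_apply, h2 x hx, smul_zero]

variable {K}

/-- An additive character of rank zero: a continuous one that is trivial on `O` and nontrivial at
some point of absolute value `q`. -/
structure IsRankZero (χ : AddChar K Circle) : Prop where
  continuous : Continuous χ
  eq_one : ∀ x : K, ‖x‖ ≤ 1 → χ x = 1
  exists_ne_one : ∃ x : K, ‖x‖ = resCard K ∧ χ x ≠ 1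

variable [MeasurableSpace K]

/-- The Fourier transform on `K`. -/
def fourier (χ : AddChar K Circle) (μ : Measure K) (f : K → ℂ) (ξ : K) : ℂ :=
  ∫ x, (χ (x * ξ) : ℂ) * f x ∂μ

/-- The inverse Fourier transform on `K`. -/
def fourierInv (χ : AddChar K Circle) (μ : Measure K) (g : K → ℂ) (x : K) : ℂ :=
  ∫ ξ, (χ (-x * ξ) : ℂ) * g ξ ∂μ

/-- Vladimirov's operator `D¹` of order one: the pseudo-differential operator with
symbol `|ξ|`. -/
def vladimirov (χ : AddChar K Circle) (μ : Measure K) (φ : K → ℂ) : K → ℂ :=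
  fourierInv χ μ fun ξ => (‖ξ‖ : ℂ) * fourier χ μ φ ξ

/-- The Hilbert space `L²(O)`: square integrable functions for the Haar measure on `O`. -/
abbrev L2O (μ : Measure K) : Type _ := Lp ℂ 2 (μ.restrict (unitBall K))

/-- Vladimirov's antiderivative `D⁻¹ φ` on `K` (convolution with a multiple of `log |x|`). -/
def antiderivative (μ : Measure K) (φ : K → ℂ) (x : K) : ℂ :=
  (((1 - resCard K) / (resCard K * Real.log (resCard K)) : ℝ) : ℂ) *
    ∫ y, (Real.log ‖x - y‖ : ℂ) * φ y ∂μ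

/-- The regularized integral `I¹ φ = D⁻¹ φ - (D⁻¹ φ)(0)`. -/
def regularizedIntegral (μ : Measure K) (φ : K → ℂ) (x : K) : ℂ :=
  antiderivative μ φ x - antiderivative μ φ 0

/-- The operator `I¹` on functions on `O`, which are extended to `K` by zero. -/
def integralO (μ : Measure K) (u : K → ℂ) (x : K) : ℂ :=
  regularizedIntegral μ ((unitBall K).indicator u) x

section Facts

variable {χ : AddChar K Circle} {μ : Measure K}

theorem fourierInv_eq (g : K → ℂ) (x : K) : fourierInv χ μ g x = fourier χ μ g (-x) := by
  simp only [fourier, fourierInv, mul_comm (-x)]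

theorem fourier_smul (c : ℂ) (f : K → ℂ) (ξ : K) :
    fourier χ μ (c • f) ξ = c * fourier χ μ f ξ := by
  rw [fourier, fourier, ← integral_const_mul]
  simp only [Pi.smul_apply, smul_eq_mul, mul_left_comm]

theorem vladimirov_smul (c : ℂ) (φ : K → ℂ) :
    vladimirov χ μ (c • φ) = c • vladimirov χ μ φ := by
  funext x
  simp only [vladimirov, Pi.smul_apply, smul_eq_mul, fourierInv_eq, ← fourier_smul]
  congr 1
  funext ξ
  simp only [Pi.smul_apply, smul_eq_mul, fourier_smul, mul_left_comm]

theorem testO_continuous {φ : K → ℂ} (hφ : φ ∈ testO K) : Continuous φ := by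
  obtain ⟨⟨d, hd, h⟩, -⟩ := hφ
  refine continuous_iff_continuousAt.2 fun x => ?_
  refine (continuousAt_const (y := φ x)).congr ?_
  filter_upwards [closedBall_mem_nhds x hd] with y hy
  rw [← h x (y - x) (by simpa [dist_eq_norm] using hy), add_sub_cancel]

variable [LocallyCompactSpace K]

theorem isCompact_closedBall_zero (r : ℝ) : IsCompact (closedBall (0 : K) r) := by
  have : ProperSpace K := .of_nontriviallyNormedField_of_weaklyLocallyCompactSpace K
  exact isCompact_closedBall 0 r

variable [BorelSpace K]

theorem integrable_of_continuous_of_zero [IsFiniteMeasureOnCompacts μ] {f : K → ℂ}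
    (hf : Continuous f) (r : ℝ) (h : ∀ x ∉ closedBall (0 : K) r, f x = 0) : Integrable f μ :=
  hf.integrable_of_hasCompactSupport (HasCompactSupport.intro (isCompact_closedBall_zero r) h)

theorem integrable_char_mul (hχ : IsRankZero χ) {f : K → ℂ} (hf : Integrable f μ) (ξ : K) :
    Integrable (fun x => (χ (x * ξ) : ℂ) * f x) μ := by
  refine hf.bdd_mul (c := 1) ?_ (Filter.Eventually.of_forall fun x => (Circle.norm_coe _).le)
  exact (continuous_subtype_val.comp
    (hχ.continuous.comp (continuous_mul_const ξ))).aestronglyMeasurable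

theorem fourier_continuous (hχ : IsRankZero χ) {f : K → ℂ} (hf : Integrable f μ) :
    Continuous (fourier χ μ f) := by
  refine continuous_of_dominated (bound := fun x => ‖f x‖)
    (fun ξ => (integrable_char_mul hχ hf ξ).aestronglyMeasurable) (fun ξ =>
      Filter.Eventually.of_forall fun x => by rw [norm_mul, Circle.norm_coe, one_mul])
    hf.norm (Filter.Eventually.of_forall fun x => ?_)
  exact (continuous_subtype_val.comp
    (hχ.continuous.comp (continuous_const_mul x))).mul continuous_const

theorem testO_integrable [IsFiniteMeasureOnCompacts μ] {φ : K → ℂ} (hφ : φ ∈ testO K) :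
    Integrable φ μ :=
  integrable_of_continuous_of_zero (testO_continuous hφ) 1 hφ.2

theorem fourier_eq_zero [μ.IsAddHaarMeasure] (hχ : IsRankZero χ) {φ : K → ℂ}
    (hφ : φ ∈ testO K) : ∃ r : ℝ, ∀ ξ ∉ closedBall (0 : K) r, fourier χ μ φ ξ = 0 := by
  obtain ⟨⟨d, hd, h⟩, -⟩ := hφ
  obtain ⟨x₀, -, hx₀⟩ := hχ.exists_ne_one
  refine ⟨‖x₀‖ / d, fun ξ hξ => ?_⟩
  have hξ' : ‖x₀‖ / d < ‖ξ‖ := by simpa using hξ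
  have h0 : 0 < ‖ξ‖ := lt_of_le_of_lt (by positivity) hξ'
  have hne : ξ ≠ 0 := norm_pos_iff.1 h0
  have hle : ‖x₀ / ξ‖ ≤ d := by
    rw [norm_div, div_le_iff₀ h0]
    rw [div_lt_iff₀ hd] at hξ'
    linarith
  have key : fourier χ μ φ ξ = (χ x₀ : ℂ) * fourier χ μ φ ξ := by
    conv_lhs => rw [fourier, ← integral_add_right_eq_self _ (x₀ / ξ)]
    rw [fourier, ← integral_const_mul]
    refine integral_congr_ae (Filter.Eventually.of_forall fun x => ?_)
    simp only [h x _ hle, add_mul, div_mul_cancel₀ _ hne, AddChar.map_add_eq_mul, Circle.coe_mul]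
    ring
  have h1 : (1 - (χ x₀ : ℂ)) * fourier χ μ φ ξ = 0 := by linear_combination key
  rcases mul_eq_zero.1 h1 with h2 | h2
  · exact absurd (Circle.ext (by simpa using (sub_eq_zero.1 h2).symm)) hx₀
  · exact h2

theorem symbol_integrable [μ.IsAddHaarMeasure] (hχ : IsRankZero χ) {φ : K → ℂ}
    (hφ : φ ∈ testO K) : Integrable (fun ξ => (‖ξ‖ : ℂ) * fourier χ μ φ ξ) μ := by
  obtain ⟨r, hr⟩ := fourier_eq_zero (μ := μ) hχ hφ
  refine integrable_of_continuous_of_zero ?_ r fun ξ hξ => by rw [hr ξ hξ, mul_zero]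
  exact (Complex.continuous_ofReal.comp continuous_norm).mul
    (fourier_continuous hχ (testO_integrable hφ))

theorem vladimirov_continuous [μ.IsAddHaarMeasure] (hχ : IsRankZero χ) {φ : K → ℂ}
    (hφ : φ ∈ testO K) : Continuous (vladimirov χ μ φ) := by
  simp only [vladimirov, funext (fourierInv_eq (χ := χ) (μ := μ) _)]
  exact (fourier_continuous hχ (symbol_integrable hχ hφ)).comp continuous_neg

theorem fourier_add (hχ : IsRankZero χ) {f g : K → ℂ} (hf : Integrable f μ)
    (hg : Integrable g μ) (ξ : K) :
    fourier χ μ (f + g) ξ = fourier χ μ f ξ + fourier χ μ g ξ := by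
  rw [fourier, fourier, fourier,
    ← integral_add (integrable_char_mul hχ hf ξ) (integrable_char_mul hχ hg ξ)]
  simp only [Pi.add_apply, mul_add]

theorem vladimirov_add [μ.IsAddHaarMeasure] (hχ : IsRankZero χ) {φ ψ : K → ℂ}
    (hφ : φ ∈ testO K) (hψ : ψ ∈ testO K) :
    vladimirov χ μ (φ + ψ) = vladimirov χ μ φ + vladimirov χ μ ψ := by
  funext x
  simp only [vladimirov, Pi.add_apply, fourierInv_eq,
    ← fourier_add hχ (symbol_integrable hχ hφ) (symbol_integrable hχ hψ)]
  congr 1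
  funext ξ
  simp only [Pi.add_apply, fourier_add hχ (testO_integrable hφ) (testO_integrable hψ), mul_add]

theorem memLp_unitBall [IsFiniteMeasureOnCompacts μ] {f : K → ℂ} (hf : Continuous f) :
    MemLp f 2 (μ.restrict (unitBall K)) := by
  have : IsFiniteMeasure (μ.restrict (unitBall K)) :=
    isFiniteMeasure_restrict.2 (isCompact_closedBall_zero 1).measure_lt_top.ne
  obtain ⟨C, hC⟩ := (isCompact_closedBall_zero (K := K) 1).exists_bound_of_continuousOn
    hf.continuousOn
  exact MemLp.of_bound hf.aestronglyMeasurable C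
    ((ae_restrict_iff' measurableSet_closedBall).2 (Filter.Eventually.of_forall hC))

/-- The linear embedding of the test functions into `L²(O)`. -/
def testToL2 (μ : Measure K) [IsFiniteMeasureOnCompacts μ] : testO K →ₗ[ℂ] L2O μ where
  toFun φ := (memLp_unitBall (testO_continuous φ.2)).toLp φ
  map_add' _ _ := rfl
  map_smul' _ _ := rfl

theorem testToL2_injective (μ : Measure K) [μ.IsAddHaarMeasure] :
    Function.Injective (testToL2 μ) := by
  rw [← LinearMap.ker_eq_bot, LinearMap.ker_eq_bot']
  intro φ hφ
  have h1 : (φ : K → ℂ) =ᵐ[μ.restrict (unitBall K)] 0 := by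
    have h2 := (memLp_unitBall (μ := μ) (testO_continuous φ.2)).coeFn_toLp
    have h3 : (memLp_unitBall (μ := μ) (testO_continuous φ.2)).toLp (φ : K → ℂ) = 0 := hφ
    rw [h3] at h2
    exact h2.symm.trans (Lp.coeFn_zero ..)
  have h4 : (φ : K → ℂ) =ᵐ[μ] 0 := by
    filter_upwards [(ae_restrict_iff' measurableSet_closedBall).1 h1] with x hx
    by_cases hxO : x ∈ unitBall K
    · exact hx hxO
    · exact φ.2.2 x hxO
  exact Subtype.ext ((testO_continuous φ.2).ae_eq_iff_eq μ continuous_zero |>.1 h4)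

/-- On test functions supported in `O`: apply `D¹` and restrict the result to `O`. -/
def vladimirovTest (χ : AddChar K Circle) (hχ : IsRankZero χ) (μ : Measure K)
    [μ.IsAddHaarMeasure] : testO K →ₗ[ℂ] L2O μ where
  toFun φ := (memLp_unitBall (vladimirov_continuous hχ φ.2)).toLp (vladimirov χ μ φ)
  map_add' φ ψ := by
    rw [← MemLp.toLp_add]
    exact MemLp.toLp_congr _ _ (Filter.EventuallyEq.of_eq (vladimirov_add hχ φ.2 ψ.2))
  map_smul' c φ := by
    rw [RingHom.id_apply, ← MemLp.toLp_const_smul]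
    exact MemLp.toLp_congr _ _ (Filter.EventuallyEq.of_eq (vladimirov_smul c _))

/-- The operator in `L²(O)` with the test functions supported in `O` as its domain, which sends
such a function `φ` to the restriction of `D¹ φ` to `O`. -/
def vladimirovOMin (χ : AddChar K Circle) (hχ : IsRankZero χ) (μ : Measure K)
    [μ.IsAddHaarMeasure] : L2O μ →ₗ.[ℂ] L2O μ where
  domain := LinearMap.range (testToL2 μ)
  toFun := vladimirovTest χ hχ μ ∘ₗ
    (LinearEquiv.ofInjective (testToL2 μ) (testToL2_injective μ)).symm.toLinearMap

/-- The operator `D_O¹`: the closure in `L²(O)` of the operator above. -/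
def vladimirovO (χ : AddChar K Circle) (hχ : IsRankZero χ) (μ : Measure K)
    [μ.IsAddHaarMeasure] : L2O μ →ₗ.[ℂ] L2O μ :=
  (vladimirovOMin χ hχ μ).closure

end Facts

end Field

end LocalFieldCalculus

end

open LocalFieldCalculus

/-! The restrictions to $O$ of the characters $e_a(x)=\chi(ax)$, $a\in K$, diagonalize both sides.
On $O$, $e_a$ depends only on $a$ modulo $O$; distinct cosets give orthogonal functions, and the
span is dense in $L^2(O)$ by Stone–Weierstrass (`dense_span_charL2`). Hence an element of $L^2(O)$
is determined by its inner products with the $e_a$.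

Pairing $(D^1\varphi)|_O$ with $e_a$ averages the symbol $|\xi|$ over the coset $-a+O$, on which
$\mathcal F\varphi$ is constant. The average is $\lambda_a=|a|$ when $|a|>1$, and
$\lambda_a=\int_O|\xi|\,d\xi=q/(q+1)$ when $|a|\le 1$ (`inner_charL2_vladimirovTest`).

Convolution over $O$ with $\frac{1-q}{q\log q}\log|x|+1$ has eigenvalue $\lambda_a^{-1}$ at $e_a$
(`antiConst_mul_integral`). The logarithm alone gives $1/|a|$ when $|a|>1$ but $1/q$ on constants;
the summand $1$ raises the latter to $(q+1)/q$ and leaves the rest unchanged. This convolution is a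
bounded injective operator $B$ with continuous values.

So $B$ is a left inverse of the minimal operator, whose range is dense. The closure of its graph is
therefore exactly $\{(By,y)\}$ (`mem_closure_graph_vladimirovOMin_iff`), whence closability,
injectivity, surjectivity and $(D_O^1)^{-1}=B$. In $Bu(x)-Bu(0)$ the contribution of the summand $1$
cancels, which leaves $I_O^1u$; the ultrametric inequality removes the region $|y|>|x|$. -/

noncomputable section

namespace LocalFieldCalculus

open scoped InnerProductSpace

/-! ### Discreteness of the absolute value -/

section Arithmetic

variable {K : Type*} [NontriviallyNormedField K] [IsUltrametricDist K]

theorem mem_integers_iff (x : K) : x ∈ integers K ↔ ‖x‖ ≤ 1 := by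
  rw [Valuation.mem_valuationSubring_iff, NormedField.valuation_apply, ← NNReal.coe_le_coe]
  simp

theorem mem_maximalIdeal_iff (x : integers K) :
    x ∈ IsLocalRing.maximalIdeal (integers K) ↔ ‖(x : K)‖ < 1 := by
  refine (Valuation.mem_maximalIdeal_iff _ _).trans ?_
  rw [NormedField.valuation_apply, ← NNReal.coe_lt_coe]
  simp

theorem norm_le_of_norm_lt_one (hK : IsNormalizedAbs K) {x : K} (hx : ‖x‖ < 1) :
    ‖x‖ ≤ (resCard K : ℝ)⁻¹ := by
  obtain ⟨β, hβ, hn⟩ := hK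
  have h1 : (⟨x, (mem_integers_iff x).2 hx.le⟩ : integers K) ∈
      IsLocalRing.maximalIdeal (integers K) := (mem_maximalIdeal_iff _).2 hx
  rw [hβ, Ideal.mem_span_singleton] at h1
  obtain ⟨c, hc⟩ := h1
  have h2 : x = β * c := congrArg Subtype.val hc
  rw [h2, norm_mul, hn]
  exact mul_le_of_le_one_right (by positivity) ((mem_integers_iff _).1 c.2)

theorem one_lt_resCard (hK : IsNormalizedAbs K) : 1 < resCard K := by
  -- `Nat.card` is $0$ for an infinite residue field; the generator would then have norm $0^{-1}=0$,
  -- so nothing nonzero would have norm below $1$.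
  have h0 : resCard K ≠ 0 := by
    intro h0
    obtain ⟨x, hx0, hx1⟩ := NormedField.exists_norm_lt_one K
    have := norm_le_of_norm_lt_one hK hx1
    rw [h0] at this
    simp at this
    simp [this] at hx0
  have h1 : resCard K ≠ 1 := by
    intro h1
    have := (Nat.card_eq_one_iff_unique.1 h1).1
    exact not_subsingleton (IsLocalRing.ResidueField (integers K)) this
  omega

theorem exists_norm_eq_inv (hK : IsNormalizedAbs K) : ∃ β : K, ‖β‖ = (resCard K : ℝ)⁻¹ := by
  obtain ⟨β, -, h⟩ := hK
  exact ⟨β, h⟩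

/-- If $q^n<|x|<q^{n+1}$, then multiplying by $\beta^{n+1}$ would give a norm strictly between
$q^{-1}$ and $1$, which the generator of the maximal ideal rules out. -/
theorem exists_norm_eq_zpow (hK : IsNormalizedAbs K) {x : K} (hx : x ≠ 0) :
    ∃ n : ℤ, ‖x‖ = (resCard K : ℝ) ^ n := by
  obtain ⟨β, hβ⟩ := exists_norm_eq_inv hK
  have hq : (1 : ℝ) < resCard K := by exact_mod_cast one_lt_resCard hK
  have hq0 : (0 : ℝ) < resCard K := by positivity
  obtain ⟨n, h1, h2⟩ := exists_mem_Ioc_zpow (norm_pos_iff.2 hx) hq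
  refine ⟨n + 1, le_antisymm h2 (not_lt.1 fun h3 => ?_)⟩
  have h4 : ‖x * β ^ (n + 1)‖ = ‖x‖ / (resCard K : ℝ) ^ (n + 1) := by
    rw [norm_mul, norm_zpow, hβ, inv_zpow, div_eq_mul_inv]
  have h5 : ‖x * β ^ (n + 1)‖ < 1 := by
    rw [h4, div_lt_one (by positivity)]; exact h3
  have h6 := norm_le_of_norm_lt_one hK h5
  rw [h4, div_le_iff₀ (by positivity), zpow_add_one₀ hq0.ne'] at h6
  field_simp at h6
  linarith

theorem exists_norm_eq_pow_inv (hK : IsNormalizedAbs K) {x : K} (hx : x ≠ 0) (h1 : ‖x‖ ≤ 1) :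
    ∃ n : ℕ, ‖x‖ = (resCard K : ℝ)⁻¹ ^ n := by
  have hq : (1 : ℝ) < resCard K := by exact_mod_cast one_lt_resCard hK
  obtain ⟨n, hn⟩ := exists_norm_eq_zpow hK hx
  have h2 : n ≤ 0 := by
    by_contra! h
    exact absurd (hn ▸ one_lt_zpow₀ hq h) (not_lt.2 h1)
  obtain ⟨m, rfl⟩ := Int.exists_eq_neg_ofNat h2
  exact ⟨m, by rw [hn, zpow_neg, inv_pow, zpow_natCast]⟩

theorem exists_norm_eq_pow (hK : IsNormalizedAbs K) {x : K} (h1 : 1 < ‖x‖) :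
    ∃ n : ℕ, ‖x‖ = (resCard K : ℝ) ^ (n + 1) := by
  obtain ⟨n, hn⟩ := exists_norm_eq_pow_inv hK (x := x⁻¹)
    (inv_ne_zero (norm_pos_iff.1 (one_pos.trans h1)))
    (by rw [norm_inv]; exact inv_le_one_of_one_le₀ h1.le)
  rw [norm_inv, inv_pow, inv_inj] at hn
  rcases n with _ | n
  · simp [hn] at h1
  · exact ⟨n, hn⟩

end Arithmetic

/-! ### Haar measure of balls and scaling by a uniformizer -/

section Scaling

variable {K : Type*} [NontriviallyNormedField K] [IsUltrametricDist K]
  [LocallyCompactSpace K] [MeasurableSpace K] [BorelSpace K]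
  {μ : Measure K} [μ.IsAddHaarMeasure]

/-- The residue classes cut $O$ into $q$ disjoint translates of the maximal ideal, all of the same
measure. -/
theorem measure_closedBall_inv (hK : IsNormalizedAbs K) (hμ : μ (unitBall K) = 1) :
    resCard K * μ (closedBall 0 (resCard K : ℝ)⁻¹) = 1 := by
  have hfin : Finite (IsLocalRing.ResidueField (integers K)) :=
    Nat.finite_of_card_ne_zero (one_lt_resCard hK).ne_bot
  have hsurj := IsLocalRing.residue_surjective (R := integers K)
  choose rep hrep using hsurj
  have hU : unitBall K = ⋃ r, closedBall ((rep r : integers K) : K) (resCard K : ℝ)⁻¹ := by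
    ext x
    simp only [Set.mem_iUnion, mem_closedBall, dist_eq_norm, sub_zero]
    have hq := one_lt_resCard hK
    constructor
    · intro hx
      refine ⟨IsLocalRing.residue _ ⟨x, (mem_integers_iff x).2 hx⟩, norm_le_of_norm_lt_one hK ?_⟩
      have := (mem_maximalIdeal_iff (⟨x, (mem_integers_iff x).2 hx⟩ -
        rep (IsLocalRing.residue _ ⟨x, (mem_integers_iff x).2 hx⟩))).1
          (by rw [← IsLocalRing.residue_eq_zero_iff, map_sub, hrep, sub_self])
      simpa using this
    · rintro ⟨r, hr⟩
      have h1 : ‖((rep r : integers K) : K)‖ ≤ 1 := (mem_integers_iff _).1 (rep r).2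
      have h2 : ‖x - (rep r : integers K)‖ ≤ 1 :=
        hr.trans (inv_le_one_of_one_le₀ (by exact_mod_cast hq.le))
      have := IsUltrametricDist.norm_add_le_max (x - (rep r : integers K))
        ((rep r : integers K) : K)
      rw [sub_add_cancel] at this
      exact this.trans (max_le h2 h1)
  have hdisj : Pairwise (Function.onFun Disjoint
      fun r => closedBall ((rep r : integers K) : K) (resCard K : ℝ)⁻¹) := by
    intro r s hrs
    rw [Function.onFun, Set.disjoint_left]
    intro x hx hy
    apply hrs
    rw [← hrep r, ← hrep s, ← sub_eq_zero, ← map_sub, IsLocalRing.residue_eq_zero_iff,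
      mem_maximalIdeal_iff]
    rw [mem_closedBall, dist_comm] at hx
    have := (dist_triangle_max ((rep r : integers K) : K) x (rep s : integers K)).trans
      (max_le hx hy)
    rw [dist_eq_norm] at this
    exact this.trans_lt (inv_lt_one_of_one_lt₀ (by exact_mod_cast one_lt_resCard hK))
  have := Fintype.ofFinite (IsLocalRing.ResidueField (integers K))
  have := measure_iUnion hdisj (fun r => measurableSet_closedBall) (μ := μ)
  rw [← hU, hμ] at this
  have h2 : ∀ r, μ (closedBall ((rep r : integers K) : K) (resCard K : ℝ)⁻¹) =
      μ (closedBall 0 (resCard K : ℝ)⁻¹) := fun r => by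
    rw [← vadd_closedBall_zero, measure_vadd]
  simp only [h2, tsum_fintype, Finset.sum_const, nsmul_eq_mul] at this
  rw [‹(1 : ENNReal) = _›, Finset.card_univ, ← Nat.card_eq_fintype_card]
  rfl

/-- The image measure is again Haar, hence a multiple of `μ`. The factor is read off on the ball of
radius $q^{-1}$, whose preimage is $O$. -/
theorem map_mul_left_eq_smul (hK : IsNormalizedAbs K) (hμ : μ (unitBall K) = 1) {β : K}
    (hβ : ‖β‖ = (resCard K : ℝ)⁻¹) : μ.map (β * ·) = (resCard K : ENNReal) • μ := by
  have hq := one_lt_resCard hK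
  have hβ0 : β ≠ 0 := by
    rw [← norm_pos_iff, hβ]; positivity
  have : SecondCountableTopology K := by
    have : ProperSpace K := .of_nontriviallyNormedField_of_weaklyLocallyCompactSpace K
    infer_instance
  have hH : (μ.map (β * ·)).IsAddHaarMeasure := by
    refine (AddEquiv.isAddHaarMeasure_map μ (DistribMulAction.toAddEquiv₀ K β hβ0) ?_ ?_)
    · exact continuous_const_mul β
    · exact continuous_const_mul β⁻¹
  have h1 := Measure.isAddLeftInvariant_eq_smul (μ.map (β * ·)) μ
  set k := Measure.addHaarScalarFactor (μ.map (β * ·)) μ with hk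
  have h2 : (μ.map (β * ·)) (closedBall 0 (resCard K : ℝ)⁻¹) = 1 := by
    rw [Measure.map_apply (by fun_prop) measurableSet_closedBall, ← hμ]
    congr 1
    ext x
    simp only [Set.mem_preimage, mem_closedBall, dist_zero_right, norm_mul, hβ]
    rw [mul_le_iff_le_one_right (by positivity)]
  have h3 := measure_closedBall_inv hK hμ
  rw [h1, Measure.smul_apply] at h2
  have hne : μ (closedBall 0 (resCard K : ℝ)⁻¹) ≠ 0 := fun h => by simp [h] at h3
  have hnt : μ (closedBall 0 (resCard K : ℝ)⁻¹) ≠ ⊤ := (isCompact_closedBall_zero _).measure_ne_top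
  have : (k : ENNReal) = resCard K := by
    rw [← ENNReal.mul_left_inj hne hnt, h3, ← h2]; rfl
  rw [h1, ← this]
  rfl

theorem setIntegral_closedBall_inv (hK : IsNormalizedAbs K) (hμ : μ (unitBall K) = 1) {β : K}
    (hβ : ‖β‖ = (resCard K : ℝ)⁻¹) {E : Type*} [NormedAddCommGroup E] [NormedSpace ℝ E]
    (f : K → E) :
    ∫ x in closedBall 0 (resCard K : ℝ)⁻¹, f x ∂μ =
      (resCard K : ℝ)⁻¹ • ∫ x in unitBall K, f (β * x) ∂μ := by
  have hq := one_lt_resCard hK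
  have hβ0 : β ≠ 0 := by
    rw [← norm_pos_iff, hβ]; positivity
  have h1 := (Homeomorph.mulLeft₀ β hβ0).measurableEmbedding.setIntegral_map (μ := μ) f
    (closedBall 0 (resCard K : ℝ)⁻¹)
  have h2 : (Homeomorph.mulLeft₀ β hβ0 : K → K) = (β * ·) := rfl
  have h3 : (β * ·) ⁻¹' closedBall 0 (resCard K : ℝ)⁻¹ = unitBall K := by
    ext x
    simp only [Set.mem_preimage, mem_closedBall, dist_zero_right, norm_mul, hβ]
    rw [mul_le_iff_le_one_right (by positivity)]
  rw [h2, h3, map_mul_left_eq_smul hK hμ hβ, Measure.restrict_smul, integral_smul_measure] at h1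
  rw [← h1, smul_smul]
  simp [show (resCard K : ℝ) ≠ 0 by positivity]

theorem measure_closedBall_pow (hK : IsNormalizedAbs K) (hμ : μ (unitBall K) = 1) (n : ℕ) :
    μ (closedBall 0 ((resCard K : ℝ)⁻¹ ^ n)) = (resCard K : ENNReal)⁻¹ ^ n := by
  have hq := one_lt_resCard hK
  obtain ⟨β, hβ⟩ := exists_norm_eq_inv hK
  induction n with
  | zero => simpa using hμ
  | succ n ih =>
    have h1 : (μ.map (β * ·)) (closedBall 0 ((resCard K : ℝ)⁻¹ ^ (n + 1))) =
        (resCard K : ENNReal)⁻¹ ^ n := by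
      rw [Measure.map_apply (by fun_prop) measurableSet_closedBall, ← ih]
      congr 1
      ext x
      simp only [Set.mem_preimage, mem_closedBall, dist_zero_right, norm_mul, hβ]
      rw [pow_succ', mul_le_mul_iff_right₀ (by positivity)]
    rw [map_mul_left_eq_smul hK hμ hβ, Measure.smul_apply, smul_eq_mul] at h1
    rw [pow_succ' (resCard K : ENNReal)⁻¹, ← h1, ← mul_assoc,
      ENNReal.inv_mul_cancel (by simp; omega) (by simp), one_mul]

/-- The unit ball splits into the unit sphere and the maximal ideal. -/
theorem setIntegral_unitBall_eq (hK : IsNormalizedAbs K) {E : Type*} [NormedAddCommGroup E]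
    [NormedSpace ℝ E] {f : K → E} (hf : IntegrableOn f (unitBall K) μ) :
    ∫ x in unitBall K, f x ∂μ =
      ∫ x in sphere 0 1, f x ∂μ + ∫ x in closedBall 0 (resCard K : ℝ)⁻¹, f x ∂μ := by
  have hq : (1 : ℝ) < resCard K := by exact_mod_cast one_lt_resCard hK
  have h1 : unitBall K = sphere 0 1 ∪ closedBall 0 (resCard K : ℝ)⁻¹ := by
    ext x
    simp only [Set.mem_union, mem_closedBall, mem_sphere, dist_zero_right]
    constructor
    · intro h
      rcases h.eq_or_lt with h | h
      · exact Or.inl h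
      · exact Or.inr (norm_le_of_norm_lt_one hK h)
    · rintro (h | h)
      · exact h.le
      · exact h.trans (inv_le_one_of_one_le₀ hq.le)
  have h2 : Disjoint (sphere (0 : K) 1) (closedBall 0 (resCard K : ℝ)⁻¹) := by
    rw [Set.disjoint_left]
    intro x hx hy
    simp only [mem_closedBall, mem_sphere, dist_zero_right] at hx hy
    rw [hx] at hy
    exact absurd hy (not_le.2 (inv_lt_one_of_one_lt₀ hq))
  rw [h1] at hf ⊢
  exact setIntegral_union h2 measurableSet_closedBall hf.left_of_union hf.right_of_union

end Scaling

/-! ### Integrals of characters and of the logarithm over the unit ball -/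

section CharacterIntegrals

variable {K : Type*} [NontriviallyNormedField K] [IsUltrametricDist K]
  [LocallyCompactSpace K] [MeasurableSpace K] [BorelSpace K]
  {μ : Measure K} [μ.IsAddHaarMeasure] {χ : AddChar K Circle}

theorem add_mem_unitBall_iff {x t : K} (ht : ‖t‖ ≤ 1) : x + t ∈ unitBall K ↔ x ∈ unitBall K := by
  simp only [mem_closedBall, dist_zero_right]
  constructor
  · intro h
    have := IsUltrametricDist.norm_add_le_max (x + t) (-t)
    rw [add_neg_cancel_right, norm_neg] at this
    exact this.trans (max_le h ht)
  · intro h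
    exact (IsUltrametricDist.norm_add_le_max x t).trans (max_le h ht)

theorem sub_mem_unitBall_iff {x t : K} (ht : ‖t‖ ≤ 1) : t - x ∈ unitBall K ↔ x ∈ unitBall K := by
  rw [sub_eq_neg_add, add_mem_unitBall_iff ht]
  simp

theorem setIntegral_unitBall_add {E : Type*} [NormedAddCommGroup E] [NormedSpace ℝ E]
    (f : K → E) {t : K} (ht : ‖t‖ ≤ 1) :
    ∫ x in unitBall K, f (x + t) ∂μ = ∫ x in unitBall K, f x ∂μ := by
  rw [← integral_indicator measurableSet_closedBall, ← integral_indicator measurableSet_closedBall,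
    ← integral_add_right_eq_self (fun x => (unitBall K).indicator f x) t]
  congr 1
  ext x
  by_cases hx : x ∈ unitBall K
  · rw [Set.indicator_of_mem hx, Set.indicator_of_mem ((add_mem_unitBall_iff ht).2 hx)]
  · rw [Set.indicator_of_notMem hx,
      Set.indicator_of_notMem fun h => hx ((add_mem_unitBall_iff ht).1 h)]

theorem measurePreserving_sub_left_unitBall {t : K} (ht : ‖t‖ ≤ 1) :
    MeasurePreserving (fun y => t - y) (μ.restrict (unitBall K)) (μ.restrict (unitBall K)) := by
  have : SecondCountableTopology K := by
    have : ProperSpace K := .of_nontriviallyNormedField_of_weaklyLocallyCompactSpace K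
    infer_instance
  have h := (Measure.measurePreserving_sub_left μ t).restrict_preimage
    (measurableSet_closedBall (x := (0 : K)) (ε := 1))
  have h2 : (fun y => t - y) ⁻¹' (unitBall K) = unitBall K := by
    ext x
    exact sub_mem_unitBall_iff ht
  rwa [h2] at h

theorem setIntegral_unitBall_sub_left {E : Type*} [NormedAddCommGroup E] [NormedSpace ℝ E]
    (f : K → E) {t : K} (ht : ‖t‖ ≤ 1) :
    ∫ x in unitBall K, f (t - x) ∂μ = ∫ x in unitBall K, f x ∂μ :=
  (measurePreserving_sub_left_unitBall ht).integral_comp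
    (Homeomorph.subLeft t).measurableEmbedding f

theorem continuous_char (hχ : IsRankZero χ) (a : K) : Continuous fun x => (χ (a * x) : ℂ) :=
  continuous_subtype_val.comp (hχ.continuous.comp (continuous_const_mul a))

theorem isFiniteMeasure_unitBall : IsFiniteMeasure (μ.restrict (unitBall K)) :=
  isFiniteMeasure_restrict.2 (isCompact_closedBall_zero 1).measure_lt_top.ne

theorem resCard_le_norm (hK : IsNormalizedAbs K) {a : K} (ha : 1 < ‖a‖) : resCard K ≤ ‖a‖ := by
  obtain ⟨n, hn⟩ := exists_norm_eq_pow hK ha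
  rw [hn]
  exact le_self_pow₀ (by exact_mod_cast (one_lt_resCard hK).le) (by simp)

theorem char_mul_eq_one (hχ : IsRankZero χ) {a x : K} (ha : ‖a‖ ≤ 1) (hx : x ∈ unitBall K) :
    (χ (a * x) : ℂ) = 1 := by
  rw [hχ.eq_one, Circle.coe_one]
  rw [norm_mul]
  exact mul_le_one₀ ha (norm_nonneg _) (by simpa using hx)

theorem integral_char_of_le (hμ : μ (unitBall K) = 1) (hχ : IsRankZero χ) {a : K}
    (ha : ‖a‖ ≤ 1) : ∫ x in unitBall K, (χ (a * x) : ℂ) ∂μ = 1 := by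
  have : ∫ x in unitBall K, (χ (a * x) : ℂ) ∂μ = ∫ x in unitBall K, (1 : ℂ) ∂μ :=
    setIntegral_congr_fun measurableSet_closedBall fun x hx => char_mul_eq_one hχ ha hx
  rw [this]
  simp [Measure.real, hμ]

/-- Translation by $x_0/a$ multiplies the integral by $\chi(x_0)\ne 1$, and it preserves $O$ because
$|a|\ge q=|x_0|$. -/
theorem integral_char_of_one_lt (hK : IsNormalizedAbs K) (hχ : IsRankZero χ) {a : K}
    (ha : 1 < ‖a‖) : ∫ x in unitBall K, (χ (a * x) : ℂ) ∂μ = 0 := by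
  obtain ⟨x₀, hx₀, hne⟩ := hχ.exists_ne_one
  have ha0 : a ≠ 0 := norm_pos_iff.1 (one_pos.trans ha)
  have ht : ‖x₀ / a‖ ≤ 1 := by
    rw [norm_div, hx₀]
    exact div_le_one_of_le₀ (resCard_le_norm hK ha) (norm_nonneg _)
  have h1 := setIntegral_unitBall_add (μ := μ) (fun x => (χ (a * x) : ℂ)) ht
  simp only [mul_add, mul_div_cancel₀ _ ha0, AddChar.map_add_eq_mul, Circle.coe_mul] at h1
  rw [integral_mul_const] at h1
  have h2 : (1 - (χ x₀ : ℂ)) * ∫ x in unitBall K, (χ (a * x) : ℂ) ∂μ = 0 := by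
    linear_combination -h1
  rcases mul_eq_zero.1 h2 with h2 | h2
  · exact absurd (Circle.ext (by simpa using (sub_eq_zero.1 h2).symm)) hne
  · exact h2

/-- On the sphere of radius $q^{-n}$ the square of the logarithm is $n^2\log^2 q$, and that sphere
lies in a ball of measure $q^{-n}$; the series $\sum n^2q^{-n}$ converges. -/
theorem memLp_log_norm (hK : IsNormalizedAbs K) (hμ : μ (unitBall K) = 1) :
    MemLp (fun y : K => Real.log ‖y‖) 2 (μ.restrict (unitBall K)) := by
  have hmeas : Measurable fun y : K => Real.log ‖y‖ := by fun_prop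
  have hq : (1 : ℝ) < resCard K := by exact_mod_cast one_lt_resCard hK
  rw [memLp_two_iff_integrable_sq hmeas.aestronglyMeasurable]
  refine ⟨(hmeas.pow_const 2).aestronglyMeasurable, ?_⟩
  rw [hasFiniteIntegral_iff_enorm]
  let F : ℕ → K → ENNReal := fun n => (closedBall 0 ((resCard K : ℝ)⁻¹ ^ n)).indicator
    fun _ => ENNReal.ofReal ((n * Real.log (resCard K)) ^ 2)
  have hF : ∀ n, Measurable (F n) := fun n => measurable_const.indicator measurableSet_closedBall
  have hle : ∫⁻ y in unitBall K, ‖Real.log ‖y‖ ^ 2‖ₑ ∂μ ≤ ∫⁻ y, ∑' n, F n y ∂μ := by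
    refine le_trans (setLIntegral_mono (g := fun y => ∑' n, F n y)
      (Measurable.tsum hF) fun y hy => ?_) (setLIntegral_le_lintegral _ _)
    rcases eq_or_ne y 0 with rfl | hy0
    · simp
    obtain ⟨n, hn⟩ := exists_norm_eq_pow_inv hK hy0 (by simpa using hy)
    refine le_trans (le_of_eq ?_) (ENNReal.le_tsum n)
    have : y ∈ closedBall (0 : K) ((resCard K : ℝ)⁻¹ ^ n) := by simp [hn]
    simp only [F, Set.indicator_of_mem this]
    rw [Real.enorm_eq_ofReal (sq_nonneg _), hn, Real.log_pow, Real.log_inv]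
    congr 1
    ring
  refine lt_of_le_of_lt hle ?_
  rw [lintegral_tsum fun n => (hF n).aemeasurable]
  have hterm : ∀ n, ∫⁻ y, F n y ∂μ = ENNReal.ofReal
      (Real.log (resCard K) ^ 2 * ((n : ℝ) ^ 2 * (resCard K : ℝ)⁻¹ ^ n)) := by
    intro n
    simp only [F]
    rw [lintegral_indicator_const measurableSet_closedBall, measure_closedBall_pow hK hμ,
      ← ENNReal.ofReal_natCast, ← ENNReal.ofReal_inv_of_pos (by positivity),
      ← ENNReal.ofReal_pow (by positivity), ← ENNReal.ofReal_mul (by positivity)]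
    congr 1
    ring
  simp only [hterm]
  have hs : Summable fun n : ℕ =>
      Real.log (resCard K) ^ 2 * ((n : ℝ) ^ 2 * (resCard K : ℝ)⁻¹ ^ n) := by
    refine Summable.mul_left _ (summable_pow_mul_geometric_of_norm_lt_one 2 ?_)
    rw [norm_inv, Real.norm_of_nonneg (by positivity)]
    exact inv_lt_one_of_one_lt₀ hq
  exact hs.tsum_ofReal_lt_top

theorem memLp_log_norm_sub (hK : IsNormalizedAbs K) (hμ : μ (unitBall K) = 1) {x : K}
    (hx : ‖x‖ ≤ 1) :
    MemLp (fun y : K => (Real.log ‖x - y‖ : ℂ)) 2 (μ.restrict (unitBall K)) :=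
  ((memLp_log_norm hK hμ).comp_measurePreserving
    (measurePreserving_sub_left_unitBall hx)).ofReal (K := ℂ)

theorem integrableOn_log_mul_char (hK : IsNormalizedAbs K) (hμ : μ (unitBall K) = 1)
    (hχ : IsRankZero χ) (a : K) :
    IntegrableOn (fun y => (Real.log ‖y‖ : ℂ) * χ (a * y)) (unitBall K) μ :=
  ((memLp_log_norm hK hμ).ofReal (K := ℂ)).integrable_mul (memLp_unitBall (continuous_char hχ a))

/-- The unit sphere contributes nothing since $\log 1=0$. The rest of $O$ is $\beta O$, where
rescaling turns $\log|y|$ into $\log|y|-\log q$ and the frequency $a$ into $a\beta$. -/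
theorem integral_log_mul_char_scale (hK : IsNormalizedAbs K) (hμ : μ (unitBall K) = 1)
    (hχ : IsRankZero χ) {β : K} (hβ : ‖β‖ = (resCard K : ℝ)⁻¹) (a : K) :
    ∫ y in unitBall K, (Real.log ‖y‖ : ℂ) * χ (a * y) ∂μ = (resCard K : ℂ)⁻¹ *
      (∫ y in unitBall K, (Real.log ‖y‖ : ℂ) * χ (a * β * y) ∂μ -
        Real.log (resCard K) * ∫ y in unitBall K, (χ (a * β * y) : ℂ) ∂μ) := by
  have hq : (1 : ℝ) < resCard K := by exact_mod_cast one_lt_resCard hK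
  rw [setIntegral_unitBall_eq hK (integrableOn_log_mul_char hK hμ hχ a),
    setIntegral_closedBall_inv hK hμ hβ]
  have h1 : ∫ y in sphere 0 1, (Real.log ‖y‖ : ℂ) * χ (a * y) ∂μ = 0 := by
    refine setIntegral_eq_zero_of_forall_eq_zero fun y hy => ?_
    rw [mem_sphere_zero_iff_norm.1 hy]
    simp
  have h2 : ∫ y in unitBall K, (Real.log ‖β * y‖ : ℂ) * χ (a * (β * y)) ∂μ =
      ∫ y in unitBall K, ((Real.log ‖y‖ : ℂ) * χ (a * β * y) -
        Real.log (resCard K) * (χ (a * β * y) : ℂ)) ∂μ := by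
    -- The product rule for `Real.log` fails only at $y=0$, where `Real.log 0 = 0`. This point is
    -- null, being contained in balls of measure $q^{-n}$.
    have : μ {(0 : K)} = 0 := by
      have hle : ∀ n : ℕ, μ {(0 : K)} ≤ (resCard K : ENNReal)⁻¹ ^ n := fun n => by
        rw [← measure_closedBall_pow hK hμ]
        exact measure_mono (by simp)
      refine le_antisymm (ge_of_tendsto' (ENNReal.tendsto_pow_atTop_nhds_zero_of_lt_one ?_) hle)
        (zero_le)
      exact ENNReal.inv_lt_one.2 (by exact_mod_cast one_lt_resCard hK)
    refine integral_congr_ae ?_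
    filter_upwards [ae_restrict_of_ae (measure_eq_zero_iff_ae_notMem.1 this)] with y hy
    have hy0 : ‖y‖ ≠ 0 := by simpa using hy
    rw [norm_mul, hβ, Real.log_mul (by positivity) hy0, Real.log_inv, mul_assoc]
    push_cast
    ring
  rw [h1, h2, integral_sub (integrableOn_log_mul_char hK hμ hχ _), integral_const_mul, zero_add]
  · simp only [Complex.real_smul]
    push_cast
    rfl
  · have := isFiniteMeasure_unitBall (μ := μ)
    exact ((memLp_unitBall (continuous_char hχ (a * β))).integrable (by simp)).const_mul _

/-- The character is $1$ on $O$ for both $a$ and $a\beta$, so the scaling relation is the linear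
equation $qJ=J-\log q$ for the integral $J$. -/
theorem integral_log_mul_char_of_le (hK : IsNormalizedAbs K) (hμ : μ (unitBall K) = 1)
    (hχ : IsRankZero χ) {a : K} (ha : ‖a‖ ≤ 1) :
    ∫ y in unitBall K, (Real.log ‖y‖ : ℂ) * χ (a * y) ∂μ =
      -(Real.log (resCard K) / (resCard K - 1)) := by
  have hq : (1 : ℝ) < resCard K := by exact_mod_cast one_lt_resCard hK
  obtain ⟨β, hβ⟩ := exists_norm_eq_inv hK
  have h1 : ∀ a : K, ‖a‖ ≤ 1 → ∫ y in unitBall K, (Real.log ‖y‖ : ℂ) * χ (a * y) ∂μ =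
      ∫ y in unitBall K, (Real.log ‖y‖ : ℂ) ∂μ := fun a ha =>
    setIntegral_congr_fun measurableSet_closedBall fun x hx =>
      (congrArg _ (char_mul_eq_one hχ ha hx)).trans (mul_one _)
  have hb : ‖a * β‖ ≤ 1 := by
    rw [norm_mul, hβ]
    exact mul_le_one₀ ha (by positivity) (inv_le_one_of_one_le₀ hq.le)
  have h2 := integral_log_mul_char_scale hK hμ hχ hβ a
  rw [h1 _ hb, ← h1 _ ha, integral_char_of_le hμ hχ hb] at h2
  have hq0 : (resCard K : ℂ) ≠ 0 := by exact_mod_cast (one_pos.trans hq).ne'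
  have hq1 : (resCard K : ℂ) - 1 ≠ 0 := sub_ne_zero.2 (by exact_mod_cast hq.ne')
  field_simp at h2 ⊢
  linear_combination h2

/-- Induction on the exponent in $|a|=q^{n+1}$. When $|a\beta|>1$ the pure character integral
vanishes, and the factor $q^{-1}$ left in the scaling relation is compensated by $|a|=q|a\beta|$.
The base case has $|a\beta|=1$ and uses the values on $O$. -/
theorem norm_mul_integral_log_mul_char (hK : IsNormalizedAbs K) (hμ : μ (unitBall K) = 1)
    (hχ : IsRankZero χ) {a : K} (ha : 1 < ‖a‖) :
    ‖a‖ * ∫ y in unitBall K, (Real.log ‖y‖ : ℂ) * χ (a * y) ∂μ =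
      -(resCard K * Real.log (resCard K) / (resCard K - 1)) := by
  have hq : (1 : ℝ) < resCard K := by exact_mod_cast one_lt_resCard hK
  have hq0 : (resCard K : ℂ) ≠ 0 := by exact_mod_cast (one_pos.trans hq).ne'
  have hq1 : (resCard K : ℂ) - 1 ≠ 0 := sub_ne_zero.2 (by exact_mod_cast hq.ne')
  obtain ⟨β, hβ⟩ := exists_norm_eq_inv hK
  obtain ⟨n, hn⟩ := exists_norm_eq_pow hK ha
  induction n generalizing a with
  | zero =>
    have hb : ‖a * β‖ ≤ 1 := by
      rw [norm_mul, hβ, hn]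
      field_simp
      simp
    rw [integral_log_mul_char_scale hK hμ hχ hβ, integral_char_of_le hμ hχ hb,
      integral_log_mul_char_of_le hK hμ hχ hb, hn]
    push_cast
    field_simp
    ring
  | succ n ih =>
    have hb : ‖a * β‖ = (resCard K : ℝ) ^ (n + 1) := by
      rw [norm_mul, hβ, hn]
      field_simp
      ring
    have hb1 : 1 < ‖a * β‖ := hb ▸ one_lt_pow₀ hq (by simp)
    rw [← ih hb1 hb, integral_log_mul_char_scale hK hμ hχ hβ, integral_char_of_one_lt hK hχ hb1,
      hn, hb]
    push_cast
    field_simp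
    ring

end CharacterIntegrals

/-! ### Characters and the convolution operator on the unit ball -/

section Operators

variable {K : Type*} [NontriviallyNormedField K] [IsUltrametricDist K]
  [LocallyCompactSpace K] [MeasurableSpace K] [BorelSpace K]
  {μ : Measure K} [μ.IsAddHaarMeasure] {χ : AddChar K Circle}

theorem conj_char (a x : K) : (starRingEnd ℂ) (χ (a * x) : ℂ) = χ (-a * x) := by
  rw [neg_mul, AddChar.map_neg_eq_inv, Circle.coe_inv_eq_conj]

theorem char_add_mul (a b x : K) : (χ ((a + b) * x) : ℂ) = χ (a * x) * χ (b * x) := by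
  rw [add_mul, AddChar.map_add_eq_mul, Circle.coe_mul]

/-- The restriction to `O` of the additive character `x ↦ χ (a x)`, as an element of `L²(O)`. -/
def charL2 (hχ : IsRankZero χ) (μ : Measure K) [μ.IsAddHaarMeasure] (a : K) : L2O μ :=
  (memLp_unitBall (μ := μ) (continuous_char hχ a)).toLp

theorem coeFn_charL2 (hχ : IsRankZero χ) (a : K) :
    charL2 hχ μ a =ᵐ[μ.restrict (unitBall K)] fun x => (χ (a * x) : ℂ) :=
  MemLp.coeFn_toLp _

theorem inner_charL2 (hχ : IsRankZero χ) (a : K) (u : L2O μ) :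
    ⟪charL2 hχ μ a, u⟫_ℂ = ∫ x in unitBall K, (χ (-a * x) : ℂ) * u x ∂μ := by
  rw [L2.inner_def]
  refine integral_congr_ae ?_
  filter_upwards [coeFn_charL2 (μ := μ) hχ a] with x hx
  rw [hx, RCLike.inner_apply, conj_char, mul_comm]

/-- Frequencies in one coset of $O$ give the same unit vector, and different cosets give orthogonal
ones. -/
theorem inner_charL2_charL2 (hK : IsNormalizedAbs K) (hμ : μ (unitBall K) = 1)
    (hχ : IsRankZero χ) (a b : K) :
    ⟪charL2 hχ μ a, charL2 hχ μ b⟫_ℂ = if ‖b - a‖ ≤ 1 then 1 else 0 := by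
  have : ⟪charL2 hχ μ a, charL2 hχ μ b⟫_ℂ = ∫ x in unitBall K, (χ ((b - a) * x) : ℂ) ∂μ := by
    rw [inner_charL2]
    refine integral_congr_ae ?_
    filter_upwards [coeFn_charL2 (μ := μ) hχ b] with x hx
    rw [hx, ← char_add_mul, neg_add_eq_sub]
  rw [this]
  split_ifs with h
  · exact integral_char_of_le hμ hχ h
  · exact integral_char_of_one_lt hK hχ (not_le.1 h)

/-! ### Density of the characters -/

section Density

/-- The restriction to `O` of the additive character `x ↦ χ (a x)`, as a continuous function. -/
def charC (hχ : IsRankZero χ) (a : K) : C(unitBall K, ℂ) :=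
  ⟨fun x => (χ (a * x) : ℂ), (continuous_char hχ a).comp continuous_subtype_val⟩

/-- The star algebra of the linear combinations of additive characters on `O`. -/
def charAlgebra (hχ : IsRankZero χ) : StarSubalgebra ℂ C(unitBall K, ℂ) where
  toSubalgebra := (Submodule.span ℂ (Set.range (charC hχ))).toSubalgebra
    (Submodule.subset_span ⟨0, by ext x; simp [charC]⟩)
    (by
      intro x y hx hy
      have h := Submodule.mul_mem_mul hx hy
      rw [Submodule.span_mul_span] at h
      refine Submodule.span_mono ?_ h
      rintro _ ⟨_, ⟨a, rfl⟩, _, ⟨b, rfl⟩, rfl⟩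
      exact ⟨a + b, by ext x; exact char_add_mul a b (x : K)⟩)
  star_mem' := by
    intro f hf
    change f ∈ Submodule.span ℂ (Set.range (charC hχ)) at hf
    change star f ∈ Submodule.span ℂ (Set.range (charC hχ))
    induction hf using Submodule.span_induction with
    | mem f hf =>
      obtain ⟨a, rfl⟩ := hf
      exact Submodule.subset_span ⟨-a, by ext x; exact (conj_char a (x : K)).symm⟩
    | zero => rw [star_zero]; exact zero_mem _
    | add f g _ _ h1 h2 => rw [star_add]; exact add_mem h1 h2
    | smul c f _ h => rw [star_smul]; exact Submodule.smul_mem _ _ h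

theorem charAlgebra_separatesPoints (hχ : IsRankZero χ) :
    (charAlgebra (K := K) hχ).SeparatesPoints := by
  intro x y hxy
  obtain ⟨x₀, -, hne⟩ := hχ.exists_ne_one
  have h0 : (x : K) - y ≠ 0 := sub_ne_zero.2 fun h => hxy (Subtype.ext h)
  -- With this frequency the values at $x$ and $y$ have quotient $\chi(x_0)\ne 1$.
  refine ⟨_, ⟨charC hχ (x₀ / (x - y)), Submodule.subset_span ⟨_, rfl⟩, rfl⟩, fun h => hne ?_⟩
  have h1 : χ (x₀ / (x - y) * x) = χ (x₀ / (x - y) * y) := Circle.ext h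
  have h2 : x₀ = x₀ / (x - y) * x - x₀ / (x - y) * y := by
    rw [← mul_sub, div_mul_cancel₀ _ h0]
  rw [h2, AddChar.map_sub_eq_div, h1, div_self']

/-- Passes from continuous functions on the compact space $O$, where Stone–Weierstrass applies, to
classes for the restricted measure on $K$. -/
theorem exists_extension_of_mem_span (hχ : IsRankZero χ) {g : C(unitBall K, ℂ)}
    (hg : g ∈ Submodule.span ℂ (Set.range (charC hχ))) :
    ∃ G : L2O μ, G ∈ Submodule.span ℂ (Set.range (charL2 hχ μ)) ∧
      ∀ᵐ x ∂μ.restrict (unitBall K), ∀ hx : x ∈ unitBall K, G x = g ⟨x, hx⟩ := by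
  induction hg using Submodule.span_induction with
  | mem f hf =>
    obtain ⟨a, rfl⟩ := hf
    refine ⟨charL2 hχ μ a, Submodule.subset_span ⟨a, rfl⟩, ?_⟩
    filter_upwards [coeFn_charL2 (μ := μ) hχ a] with x hx hxO
    exact hx
  | zero =>
    refine ⟨0, zero_mem _, ?_⟩
    filter_upwards [Lp.coeFn_zero ℂ 2 (μ.restrict (unitBall K))] with x hx hxO
    exact hx
  | add f g _ _ h1 h2 =>
    obtain ⟨F, hF, hF'⟩ := h1
    obtain ⟨G, hG, hG'⟩ := h2
    refine ⟨F + G, add_mem hF hG, ?_⟩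
    filter_upwards [Lp.coeFn_add F G, hF', hG'] with x hx h1 h2 hxO
    rw [hx, Pi.add_apply, h1 hxO, h2 hxO]
    rfl
  | smul c f _ h =>
    obtain ⟨F, hF, hF'⟩ := h
    refine ⟨c • F, Submodule.smul_mem _ _ hF, ?_⟩
    filter_upwards [Lp.coeFn_smul c F, hF'] with x hx h1 hxO
    rw [hx, Pi.smul_apply, h1 hxO]
    rfl

/-- Bounded continuous functions are dense in $L^2(O)$. Stone–Weierstrass approximates each of them
uniformly on $O$, and the uniform norm dominates the $L^2$ norm because $O$ has measure $1$. -/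
theorem dense_span_charL2 (hμ : μ (unitBall K) = 1) (hχ : IsRankZero χ) :
    Dense (Submodule.span ℂ (Set.range (charL2 hχ μ)) : Set (L2O μ)) := by
  have : ProperSpace K := .of_nontriviallyNormedField_of_weaklyLocallyCompactSpace K
  have := isFiniteMeasure_unitBall (μ := μ)
  have : CompactSpace (unitBall K) := isCompact_iff_compactSpace.1 (isCompact_closedBall_zero 1)
  have hd := BoundedContinuousFunction.toLp_denseRange (p := 2) ℂ (μ.restrict (unitBall K)) ℂ
    (by simp)
  rw [← dense_closure]
  refine hd.mono ?_
  rintro _ ⟨f, rfl⟩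
  rw [Metric.mem_closure_iff]
  intro ε hε
  have htop := ContinuousMap.starSubalgebra_topologicalClosure_eq_top_of_separatesPoints
    (charAlgebra (K := K) hχ) (charAlgebra_separatesPoints hχ)
  have hf : f.toContinuousMap.restrict (unitBall K) ∈
      closure (charAlgebra hχ : Set C(unitBall K, ℂ)) := by
    rw [← StarSubalgebra.topologicalClosure_coe, htop]
    trivial
  obtain ⟨g, hg, hfg⟩ := Metric.mem_closure_iff.1 hf (ε / 2) (half_pos hε)
  obtain ⟨G, hG, hG'⟩ := exists_extension_of_mem_span (μ := μ) hχ hg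
  refine ⟨G, hG, lt_of_le_of_lt ?_ (half_lt_self hε)⟩
  rw [dist_eq_norm]
  refine (Lp.norm_le_of_ae_bound (C := ε / 2) (half_pos hε).le ?_).trans ?_
  · filter_upwards [Lp.coeFn_sub (BoundedContinuousFunction.toLp 2 (μ.restrict (unitBall K)) ℂ f) G,
      BoundedContinuousFunction.coeFn_toLp 2 (μ.restrict (unitBall K)) ℂ f, hG',
      ae_restrict_mem measurableSet_closedBall] with x h1 h2 h3 h4
    rw [h1, Pi.sub_apply, h2, h3 h4, ← dist_eq_norm]
    exact (ContinuousMap.dist_apply_le_dist (f := f.toContinuousMap.restrict (unitBall K))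
      (g := g) ⟨x, h4⟩).trans hfg.le
  · simp [measureUnivNNReal, hμ]

theorem eq_of_inner_charL2_eq (hμ : μ (unitBall K) = 1) (hχ : IsRankZero χ) {u v : L2O μ}
    (h : ∀ a, ⟪charL2 hχ μ a, u⟫_ℂ = ⟪charL2 hχ μ a, v⟫_ℂ) : u = v := by
  refine (dense_span_charL2 hμ hχ).eq_of_inner_left ℂ fun w hw => ?_
  induction hw using Submodule.span_induction with
  | mem f hf =>
    obtain ⟨a, rfl⟩ := hf
    have := congrArg (starRingEnd ℂ) (h a)
    simpa using this
  | zero => simp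
  | add f g _ _ h1 h2 => simp only [inner_add_right, h1, h2]
  | smul c f _ h => simp only [inner_smul_right, h]

end Density

/-! ### The candidate inverse as an integral operator -/

section IntegralOperator

/-- The multiplier of Vladimirov's antiderivative. -/
def antiConst (K : Type*) [NontriviallyNormedField K] [IsUltrametricDist K] : ℝ :=
  (1 - resCard K) / (resCard K * Real.log (resCard K))

/-- The inverse of `D_O¹`: the antiderivative corrected by the mean value. -/
def solution (u : L2O μ) (x : K) : ℂ :=
  ∫ y in unitBall K, ((antiConst K : ℂ) * (Real.log ‖x - y‖ : ℂ) + 1) * u y ∂μ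

/-- The eigenvalue of `D_O¹` at the restriction to `O` of `x ↦ χ (a x)`. -/
def eigenvalue (a : K) : ℝ := if ‖a‖ ≤ 1 then resCard K / (resCard K + 1) else ‖a‖

theorem eigenvalue_pos (hK : IsNormalizedAbs K) (a : K) : 0 < eigenvalue a := by
  have hq : (1 : ℝ) < resCard K := by exact_mod_cast one_lt_resCard hK
  rw [eigenvalue]
  split_ifs with h
  · positivity
  · exact one_pos.trans (not_le.1 h)

/-- Consistency of the eigenvalues: `charL2 hχ μ a` depends only on $a$ modulo $O$. -/
theorem eigenvalue_eq_of_norm_sub_le {a b : K} (h : ‖b - a‖ ≤ 1) :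
    eigenvalue a = eigenvalue b := by
  have h1 : ‖a‖ ≤ 1 ↔ ‖b‖ ≤ 1 := by
    have := add_mem_unitBall_iff (x := a) h
    simpa [mem_closedBall] using this.symm
  rw [eigenvalue, eigenvalue]
  by_cases h2 : ‖a‖ ≤ 1
  · rw [if_pos h2, if_pos (h1.1 h2)]
  · have h3 : ‖b‖ = ‖a‖ := by
      have h4 : ‖a‖ ≠ ‖b - a‖ := (h.trans_lt (not_le.1 h2)).ne'
      have := IsUltrametricDist.norm_add_eq_max_of_norm_ne_norm h4
      rw [add_sub_cancel, max_eq_left (h.trans (not_le.1 h2).le)] at this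
      exact this
    rw [if_neg h2, if_neg (mt h1.2 h2), h3]

theorem memLp_kernel (hK : IsNormalizedAbs K) (hμ : μ (unitBall K) = 1) {x : K} (hx : ‖x‖ ≤ 1) :
    MemLp (fun y => (antiConst K : ℂ) * (Real.log ‖x - y‖ : ℂ) + 1) 2
      (μ.restrict (unitBall K)) := by
  have := isFiniteMeasure_unitBall (μ := μ)
  exact ((memLp_log_norm_sub hK hμ hx).const_mul _).add (memLp_const 1)

/-- The norm of the kernel does not depend on $x$, because $y\mapsto x-y$ preserves the measure on
$O$. Cauchy–Schwarz then bounds `solution u` uniformly on $O$ by a multiple of the norm of `u`. -/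
theorem exists_kernel (hK : IsNormalizedAbs K) (hμ : μ (unitBall K) = 1) :
    ∃ C : ℝ, ∀ x : K, ‖x‖ ≤ 1 → ∃ k : L2O μ, ‖k‖ = C ∧ ∀ u : L2O μ, solution u x = ⟪k, u⟫_ℂ := by
  refine ⟨‖(memLp_kernel hK hμ (x := 0) (by simp)).toLp‖, fun x hx =>
    ⟨(memLp_kernel hK hμ hx).toLp, ?_, fun u => ?_⟩⟩
  · rw [Lp.norm_toLp, Lp.norm_toLp]
    congr 1
    have h0 : ∀ t : K, ‖t‖ ≤ 1 → eLpNorm (fun y =>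
        (antiConst K : ℂ) * (Real.log ‖t - y‖ : ℂ) + 1) 2 (μ.restrict (unitBall K)) =
        eLpNorm (fun y => (antiConst K : ℂ) * (Real.log ‖y‖ : ℂ) + 1) 2
          (μ.restrict (unitBall K)) := fun t ht =>
      eLpNorm_comp_measurePreserving (g := fun y =>
        (antiConst K : ℂ) * (Real.log ‖y‖ : ℂ) + 1)
        (Measurable.aestronglyMeasurable (by fun_prop)) (measurePreserving_sub_left_unitBall ht)
    rw [h0 x hx, h0 0 (by simp)]
  · rw [L2.inner_def]
    -- The kernel is real, so the conjugation in the inner product has no effect.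
    refine integral_congr_ae ?_
    filter_upwards [(memLp_kernel hK hμ hx).coeFn_toLp] with y hy
    rw [hy, RCLike.inner_apply, map_add, map_mul, Complex.conj_ofReal, Complex.conj_ofReal,
      map_one, mul_comm]

theorem solution_add (hK : IsNormalizedAbs K) (hμ : μ (unitBall K) = 1) {x : K} (hx : ‖x‖ ≤ 1)
    (u v : L2O μ) : solution (u + v) x = solution u x + solution v x := by
  obtain ⟨C, hC⟩ := exists_kernel hK hμ
  obtain ⟨k, -, hk⟩ := hC x hx
  rw [hk, hk, hk, inner_add_right]

theorem solution_smul (hK : IsNormalizedAbs K) (hμ : μ (unitBall K) = 1) {x : K} (hx : ‖x‖ ≤ 1)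
    (c : ℂ) (u : L2O μ) : solution (c • u) x = c * solution u x := by
  obtain ⟨C, hC⟩ := exists_kernel hK hμ
  obtain ⟨k, -, hk⟩ := hC x hx
  rw [hk, hk, inner_smul_right]

theorem antiConst_mul_integral (hK : IsNormalizedAbs K) (hμ : μ (unitBall K) = 1)
    (hχ : IsRankZero χ) (a : K) :
    (antiConst K : ℂ) * ∫ y in unitBall K, (Real.log ‖y‖ : ℂ) * χ (a * y) ∂μ +
      ∫ y in unitBall K, (χ (a * y) : ℂ) ∂μ = (eigenvalue a : ℂ)⁻¹ := by
  have hq : (1 : ℝ) < resCard K := by exact_mod_cast one_lt_resCard hK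
  have hq0 : (resCard K : ℂ) ≠ 0 := by exact_mod_cast (one_pos.trans hq).ne'
  have hq1 : (resCard K : ℂ) - 1 ≠ 0 := sub_ne_zero.2 (by exact_mod_cast hq.ne')
  have hq2 : (resCard K : ℂ) + 1 ≠ 0 := by exact_mod_cast (by positivity : (resCard K : ℝ) + 1 ≠ 0)
  have hl : (Real.log (resCard K) : ℂ) ≠ 0 := by exact_mod_cast (Real.log_pos hq).ne'
  by_cases h : ‖a‖ ≤ 1
  · rw [integral_log_mul_char_of_le hK hμ hχ h, integral_char_of_le hμ hχ h, eigenvalue, if_pos h,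
      antiConst]
    push_cast at hl ⊢
    field_simp
    ring
  · rw [not_le] at h
    have h1 := norm_mul_integral_log_mul_char hK hμ hχ h
    have ha : (‖a‖ : ℂ) ≠ 0 := by exact_mod_cast (one_pos.trans h).ne'
    rw [integral_char_of_one_lt hK hχ h, eigenvalue, if_neg (not_le.2 h), add_zero]
    refine eq_inv_of_mul_eq_one_left ?_
    rw [mul_assoc, mul_comm _ (‖a‖ : ℂ), h1, antiConst]
    push_cast at hl ⊢
    field_simp
    ring

/-- A convolution over the additive group $O$ acts on a character through the Fourier coefficient of
its kernel, as the substitution $y\mapsto x-y$ shows. -/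
theorem solution_charL2 (hK : IsNormalizedAbs K) (hμ : μ (unitBall K) = 1) (hχ : IsRankZero χ)
    (a : K) {x : K} (hx : ‖x‖ ≤ 1) :
    solution (charL2 hχ μ a) x = (eigenvalue a : ℂ)⁻¹ * χ (a * x) := by
  have := isFiniteMeasure_unitBall (μ := μ)
  have he : eigenvalue a = eigenvalue (-a) := by simp only [eigenvalue, norm_neg]
  have h1 : solution (charL2 hχ μ a) x = ∫ y in unitBall K,
      ((antiConst K : ℂ) * (Real.log ‖x - y‖ : ℂ) + 1) * χ (a * y) ∂μ := by
    refine integral_congr_ae ?_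
    filter_upwards [coeFn_charL2 (μ := μ) hχ a] with y hy
    rw [hy]
  have h2 : ∀ y : K, ((antiConst K : ℂ) * (Real.log ‖x - (x - y)‖ : ℂ) + 1) * χ (a * (x - y)) =
      χ (a * x) * ((antiConst K : ℂ) * ((Real.log ‖y‖ : ℂ) * χ (-a * y)) + χ (-a * y)) := by
    intro y
    have : a * (x - y) = a * x + -a * y := by ring
    rw [sub_sub_cancel, this, AddChar.map_add_eq_mul, Circle.coe_mul]
    ring
  rw [h1, ← setIntegral_unitBall_sub_left _ hx]
  simp only [h2]
  rw [integral_const_mul, integral_add ((integrableOn_log_mul_char hK hμ hχ _).const_mul _)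
    ((memLp_unitBall (continuous_char hχ (-a))).integrable (by simp)), integral_const_mul,
    antiConst_mul_integral hK hμ hχ, he, mul_comm]

/-- Convergence of $u$ in $L^2(O)$ gives uniform convergence of `solution u` on $O$, and
combinations of characters are mapped to continuous functions. -/
theorem continuousOn_solution (hK : IsNormalizedAbs K) (hμ : μ (unitBall K) = 1)
    (hχ : IsRankZero χ) (u : L2O μ) : ContinuousOn (solution u) (unitBall K) := by
  obtain ⟨C, hC⟩ := exists_kernel (μ := μ) hK hμ
  have hC0 : 0 ≤ C := by
    obtain ⟨k, hk, -⟩ := hC 0 (by simp)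
    exact hk ▸ norm_nonneg k
  refine continuousOn_of_uniform_approx_of_continuousOn fun s hs => ?_
  obtain ⟨ε, hε, hs⟩ := Metric.mem_uniformity_dist.1 hs
  obtain ⟨v, hv, huv⟩ := Metric.mem_closure_iff.1 ((dense_span_charL2 hμ hχ).closure_eq ▸
    Set.mem_univ u) (ε / (C + 1)) (by positivity)
  refine ⟨solution v, ?_, fun x hx => hs ?_⟩
  · clear huv
    induction hv using Submodule.span_induction with
    | mem f hf =>
      obtain ⟨a, rfl⟩ := hf
      refine ((continuous_char hχ a).const_mul ((eigenvalue a : ℂ)⁻¹)).continuousOn.congr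
        fun x hx => ?_
      exact solution_charL2 hK hμ hχ a (by simpa using hx)
    | zero =>
      refine (continuousOn_const (c := (0 : ℂ))).congr fun x hx => ?_
      obtain ⟨k, -, hk⟩ := hC x (by simpa using hx)
      rw [hk, inner_zero_right]
    | add f g _ _ h1 h2 =>
      exact (h1.add h2).congr fun x hx => solution_add hK hμ (by simpa using hx) f g
    | smul c f _ h =>
      exact (h.const_mul c).congr fun x hx => solution_smul hK hμ (by simpa using hx) c f
  · obtain ⟨k, hkC, hk⟩ := hC x (by simpa using hx)
    rw [hk, hk, dist_eq_norm, ← inner_sub_right]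
    refine (norm_inner_le_norm k (u - v)).trans_lt ?_
    rw [hkC, ← dist_eq_norm]
    rw [lt_div_iff₀ (by positivity)] at huv
    nlinarith [dist_nonneg (x := u) (y := v)]

theorem exists_solution_operator (hK : IsNormalizedAbs K) (hμ : μ (unitBall K) = 1)
    (hχ : IsRankZero χ) :
    ∃ B : L2O μ →L[ℂ] L2O μ, ∀ u, B u =ᵐ[μ.restrict (unitBall K)] solution u := by
  have := isFiniteMeasure_unitBall (μ := μ)
  obtain ⟨C, hC⟩ := exists_kernel (μ := μ) hK hμ
  have hC0 : 0 ≤ C := by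
    obtain ⟨k, hk, -⟩ := hC 0 (by simp)
    exact hk ▸ norm_nonneg k
  have hbd : ∀ u : L2O μ, ∀ᵐ x ∂μ.restrict (unitBall K), ‖solution u x‖ ≤ C * ‖u‖ := by
    intro u
    filter_upwards [ae_restrict_mem measurableSet_closedBall] with x hx
    obtain ⟨k, hkC, hk⟩ := hC x (by simpa using hx)
    rw [hk, ← hkC]
    exact norm_inner_le_norm k u
  have hmem : ∀ u : L2O μ, MemLp (solution u) 2 (μ.restrict (unitBall K)) := fun u =>
    MemLp.of_bound ((continuousOn_solution hK hμ hχ u).aestronglyMeasurable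
      measurableSet_closedBall) _ (hbd u)
  let B : L2O μ →ₗ[ℂ] L2O μ :=
    { toFun := fun u => (hmem u).toLp
      map_add' := fun u v => by
        rw [← MemLp.toLp_add]
        refine MemLp.toLp_congr _ _ ?_
        filter_upwards [ae_restrict_mem measurableSet_closedBall] with x hx
        exact solution_add hK hμ (by simpa using hx) u v
      map_smul' := fun c u => by
        rw [RingHom.id_apply, ← MemLp.toLp_const_smul]
        refine MemLp.toLp_congr _ _ ?_
        filter_upwards [ae_restrict_mem measurableSet_closedBall] with x hx
        exact solution_smul hK hμ (by simpa using hx) c u }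
  refine ⟨B.mkContinuous C fun u => ?_, fun u => (hmem u).coeFn_toLp⟩
  refine (Lp.norm_le_of_ae_bound (C := C * ‖u‖) (by positivity) ?_).trans ?_
  · filter_upwards [(hmem u).coeFn_toLp, hbd u] with x h1 h2
    exact (congrArg norm h1).trans_le h2
  · simp [measureUnivNNReal, hμ]

/-- Both sides are bounded linear functionals of `u`, so it is enough to compare them on characters.
-/
theorem inner_charL2_solution (hK : IsNormalizedAbs K) (hμ : μ (unitBall K) = 1)
    (hχ : IsRankZero χ) {B : L2O μ →L[ℂ] L2O μ}
    (hB : ∀ u, B u =ᵐ[μ.restrict (unitBall K)] solution u) (a : K) (u : L2O μ) :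
    ⟪charL2 hχ μ a, B u⟫_ℂ = (eigenvalue a : ℂ)⁻¹ * ⟪charL2 hχ μ a, u⟫_ℂ := by
  have h : (innerSL ℂ (charL2 hχ μ a)).comp B =
      (eigenvalue a : ℂ)⁻¹ • innerSL ℂ (charL2 hχ μ a) := by
    refine ContinuousLinearMap.ext_on (dense_span_charL2 hμ hχ) ?_
    rintro _ ⟨b, rfl⟩
    have h1 : B (charL2 hχ μ b) = (eigenvalue b : ℂ)⁻¹ • charL2 hχ μ b := by
      refine Lp.ext ?_
      filter_upwards [hB (charL2 hχ μ b), coeFn_charL2 (μ := μ) hχ b,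
        Lp.coeFn_smul (eigenvalue b : ℂ)⁻¹ (charL2 hχ μ b),
        ae_restrict_mem measurableSet_closedBall] with x h1 h2 h3 h4
      rw [h1, h3, Pi.smul_apply, h2, solution_charL2 hK hμ hχ b (by simpa using h4), smul_eq_mul]
    simp only [ContinuousLinearMap.comp_apply, _root_.smul_apply, innerSL_apply_apply,
      h1, inner_smul_right, smul_eq_mul, inner_charL2_charL2 hK hμ hχ]
    split_ifs with h
    · rw [eigenvalue_eq_of_norm_sub_le h]
    · simp
  exact congrArg (fun f : L2O μ →L[ℂ] ℂ => f u) h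

end IntegralOperator

end Operators

/-! ### Diagonalization of Vladimirov's operator and its closure -/

section VladimirovOperator

variable {K : Type*} [NontriviallyNormedField K] [IsUltrametricDist K]
  [LocallyCompactSpace K] [MeasurableSpace K] [BorelSpace K]
  {μ : Measure K} [μ.IsAddHaarMeasure] {χ : AddChar K Circle}

theorem integral_norm_unitBall (hK : IsNormalizedAbs K) (hμ : μ (unitBall K) = 1) :
    ∫ x in unitBall K, (‖x‖ : ℂ) ∂μ = resCard K / (resCard K + 1) := by
  have hq : (1 : ℝ) < resCard K := by exact_mod_cast one_lt_resCard hK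
  have hq0 : (resCard K : ℂ) ≠ 0 := by exact_mod_cast (one_pos.trans hq).ne'
  have hq1 : (resCard K : ℂ) - 1 ≠ 0 := sub_ne_zero.2 (by exact_mod_cast hq.ne')
  have hq2 : (resCard K : ℂ) + 1 ≠ 0 := by exact_mod_cast (by positivity : (resCard K : ℝ) + 1 ≠ 0)
  have := isFiniteMeasure_unitBall (μ := μ)
  obtain ⟨β, hβ⟩ := exists_norm_eq_inv hK
  have h1 := setIntegral_unitBall_eq (μ := μ) hK (f := fun x => (‖x‖ : ℂ))
    ((memLp_unitBall (by fun_prop)).integrable (by simp) (μ := μ.restrict (unitBall K)) (q := 2))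
  have h2 := setIntegral_unitBall_eq (μ := μ) hK (f := fun _ => (1 : ℂ)) (by simp [hμ])
  have h3 : ∫ x in sphere (0 : K) 1, (‖x‖ : ℂ) ∂μ = ∫ x in sphere (0 : K) 1, (1 : ℂ) ∂μ :=
    setIntegral_congr_fun isClosed_sphere.measurableSet fun x hx => by
      simp [mem_sphere_zero_iff_norm.1 hx]
  rw [setIntegral_closedBall_inv hK hμ hβ] at h1 h2
  have h4 : ∫ x in unitBall K, (1 : ℂ) ∂μ = 1 := by simp [Measure.real, hμ]
  rw [h3] at h1
  simp only [norm_mul, hβ, Complex.ofReal_mul, integral_const_mul, Complex.real_smul] at h1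
  rw [h4] at h2
  simp only [Complex.real_smul] at h2
  push_cast at h1 h2
  set I := ∫ x in unitBall K, (‖x‖ : ℂ) ∂μ
  set S := ∫ x in sphere (0 : K) 1, (1 : ℂ) ∂μ
  -- Splitting off the unit sphere gives $I=S+q^{-2}I$ and $1=S+q^{-1}$; eliminate $S$.
  have h5 : (resCard K : ℂ) * (resCard K + 1) * (resCard K - 1) * I =
      (resCard K : ℂ) * resCard K * (resCard K - 1) := by
    field_simp at h1 h2
    linear_combination (resCard K : ℂ) * h1 - (resCard K : ℂ) * resCard K * h2
  field_simp
  refine mul_left_cancel₀ (mul_ne_zero hq0 hq1) ?_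
  linear_combination h5

/-- This averages $|\xi|$ over the coset $-a+O$: the norm is constant there when $|a|>1$, and the
coset is $O$ itself otherwise. -/
theorem integral_norm_ball_eq_eigenvalue (hK : IsNormalizedAbs K) (hμ : μ (unitBall K) = 1)
    (a : K) : ∫ ξ, (unitBall K).indicator (fun _ => (1 : ℂ)) (a + ξ) * (‖ξ‖ : ℂ) ∂μ =
      eigenvalue a := by
  rw [← integral_sub_right_eq_self _ a]
  have h1 : ∀ ξ : K, (unitBall K).indicator (fun _ => (1 : ℂ)) (a + (ξ - a)) * (‖ξ - a‖ : ℂ) =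
      (unitBall K).indicator (fun ξ => (‖ξ - a‖ : ℂ)) ξ := by
    intro ξ
    rw [add_sub_cancel]
    by_cases h : ξ ∈ unitBall K
    · simp only [Set.indicator_of_mem h, one_mul]
    · simp only [Set.indicator_of_notMem h, zero_mul]
  simp only [h1]
  rw [integral_indicator measurableSet_closedBall, eigenvalue]
  split_ifs with h
  · have := setIntegral_unitBall_add (μ := μ) (fun x : K => (‖x‖ : ℂ)) (t := -a) (by simpa using h)
    simp only [← sub_eq_add_neg] at this
    rw [this, integral_norm_unitBall hK hμ]
    push_cast
    rfl
  · rw [not_le] at h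
    have : ∫ x in unitBall K, (‖x - a‖ : ℂ) ∂μ = ∫ x in unitBall K, (‖a‖ : ℂ) ∂μ := by
      refine setIntegral_congr_fun measurableSet_closedBall fun x hx => ?_
      have hx' : ‖x‖ < ‖a‖ := lt_of_le_of_lt (by simpa using hx) h
      have h2 : ‖x - a‖ = ‖a‖ := by
        rw [sub_eq_add_neg, IsUltrametricDist.norm_add_eq_max_of_norm_ne_norm
          (by rw [norm_neg]; exact hx'.ne), norm_neg, max_eq_right hx'.le]
      simp only [h2]
    rw [this]
    simp [Measure.real, hμ]

theorem fourier_eq_inner (hχ : IsRankZero χ) (φ : testO K) (a : K) :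
    fourier χ μ φ (-a) = ⟪charL2 hχ μ a, testToL2 μ φ⟫_ℂ := by
  rw [inner_charL2]
  have h1 : ∫ x in unitBall K, (χ (-a * x) : ℂ) * testToL2 μ φ x ∂μ =
      ∫ x in unitBall K, (χ (-a * x) : ℂ) * (φ : K → ℂ) x ∂μ := by
    refine integral_congr_ae ?_
    filter_upwards [(memLp_unitBall (μ := μ) (testO_continuous φ.2)).coeFn_toLp] with x hx
    rw [← hx]
    rfl
  rw [h1, setIntegral_eq_integral_of_forall_compl_eq_zero fun x hx => by
    rw [φ.2.2 x hx, mul_zero]]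
  simp only [fourier, mul_comm _ (-a)]

/-- Since $\varphi$ is supported in $O$ and $\chi$ is trivial there, the transform is invariant
under translations by $O$. -/
theorem fourier_eq_of_norm_add_le (hχ : IsRankZero χ) (φ : testO K) {a ξ : K}
    (h : ‖a + ξ‖ ≤ 1) : fourier χ μ φ ξ = fourier χ μ φ (-a) := by
  refine integral_congr_ae (Filter.Eventually.of_forall fun x => ?_)
  by_cases hx : x ∈ unitBall K
  · have h1 : x * ξ = (a + ξ) * x + x * -a := by ring
    simp only [h1, AddChar.map_add_eq_mul, Circle.coe_mul, char_mul_eq_one hχ h hx, one_mul]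
  · simp only [φ.2.2 x hx, mul_zero]

/-- By Fubini, the integral over $x\in O$ becomes the indicator of $a+\xi\in O$. On that coset the
transform of $\varphi$ is the constant $\mathcal F\varphi(-a)$, and the remaining integral of
$|\xi|$ is the eigenvalue. -/
theorem inner_charL2_vladimirovTest (hK : IsNormalizedAbs K) (hμ : μ (unitBall K) = 1)
    (hχ : IsRankZero χ) (a : K) (φ : testO K) :
    ⟪charL2 hχ μ a, vladimirovTest χ hχ μ φ⟫_ℂ =
      eigenvalue a * ⟪charL2 hχ μ a, testToL2 μ φ⟫_ℂ := by
  have : ProperSpace K := .of_nontriviallyNormedField_of_weaklyLocallyCompactSpace K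
  have := isFiniteMeasure_unitBall (μ := μ)
  set g : K → ℂ := fun ξ => (‖ξ‖ : ℂ) * fourier χ μ φ ξ with hg
  have hgi : Integrable g μ := symbol_integrable (μ := μ) hχ φ.2
  have h1 : ⟪charL2 hχ μ a, vladimirovTest χ hχ μ φ⟫_ℂ =
      ∫ x in unitBall K, ∫ ξ, (χ (-(a + ξ) * x) : ℂ) * g ξ ∂μ ∂μ := by
    rw [inner_charL2]
    refine integral_congr_ae ?_
    filter_upwards [(memLp_unitBall (μ := μ) (vladimirov_continuous (μ := μ) hχ φ.2)).coeFn_toLp]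
      with x hx
    have h2 : vladimirovTest χ hχ μ φ x = vladimirov χ μ φ x := hx
    rw [h2, vladimirov, fourierInv, ← integral_const_mul]
    refine integral_congr_ae (Filter.Eventually.of_forall fun ξ => ?_)
    have h3 : -(a + ξ) * x = -a * x + -x * ξ := by ring
    simp only [h3, AddChar.map_add_eq_mul, Circle.coe_mul, mul_assoc, hg]
  have hcont : Continuous fun p : K × K => (χ (-(a + p.2) * p.1) : ℂ) :=
    continuous_subtype_val.comp (hχ.continuous.comp (by fun_prop))
  have hint : Integrable (Function.uncurry fun x ξ => (χ (-(a + ξ) * x) : ℂ) * g ξ)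
      ((μ.restrict (unitBall K)).prod μ) :=
    (hgi.comp_snd (μ.restrict (unitBall K))).bdd_mul (c := 1) hcont.aestronglyMeasurable
      (Filter.Eventually.of_forall fun p => (Circle.norm_coe _).le)
  rw [h1, integral_integral_swap hint]
  have h2 : ∀ ξ, ∫ x in unitBall K, (χ (-(a + ξ) * x) : ℂ) * g ξ ∂μ =
      ((unitBall K).indicator (fun _ => (1 : ℂ)) (a + ξ) * (‖ξ‖ : ℂ)) * fourier χ μ φ (-a) := by
    intro ξ
    rw [integral_mul_const]
    by_cases h : a + ξ ∈ unitBall K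
    · have h' : ‖a + ξ‖ ≤ 1 := by simpa using h
      rw [Set.indicator_of_mem h, integral_char_of_le hμ hχ (by rwa [norm_neg]), one_mul, one_mul,
        hg, ← fourier_eq_of_norm_add_le hχ φ h']
    · have h' : 1 < ‖a + ξ‖ := by simpa using h
      rw [Set.indicator_of_notMem h, integral_char_of_one_lt hK hχ (by rwa [norm_neg]), zero_mul,
        zero_mul, zero_mul]
  simp only [h2]
  rw [integral_mul_const, integral_norm_ball_eq_eigenvalue hK hμ, fourier_eq_inner hχ]

theorem indicator_char_mem_testO (hχ : IsRankZero χ) (a : K) :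
    (unitBall K).indicator (fun x => (χ (a * x) : ℂ)) ∈ testO K := by
  -- This radius makes both $|t|\le 1$ and $|at|\le 1$, so a shift by $t$ changes neither the
  -- indicator nor the character.
  refine ⟨⟨(‖a‖ + 1)⁻¹, by positivity, fun x t ht => ?_⟩,
    fun x hx => Set.indicator_of_notMem hx _⟩
  have ht1 : ‖t‖ ≤ 1 := ht.trans (inv_le_one_of_one_le₀ (by linarith [norm_nonneg a]))
  have hat : χ (a * t) = 1 := hχ.eq_one _ (by
    rw [norm_mul]
    calc ‖a‖ * ‖t‖ ≤ (‖a‖ + 1) * (‖a‖ + 1)⁻¹ := by gcongr; linarith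
      _ = 1 := mul_inv_cancel₀ (by positivity))
  by_cases hx : x ∈ unitBall K
  · rw [Set.indicator_of_mem hx, Set.indicator_of_mem ((add_mem_unitBall_iff ht1).2 hx), mul_add,
      AddChar.map_add_eq_mul, hat, mul_one]
  · rw [Set.indicator_of_notMem hx,
      Set.indicator_of_notMem fun h => hx ((add_mem_unitBall_iff ht1).1 h)]

/-- Each character cut off to $O$ is a test function and an eigenvector with nonzero eigenvalue, so
the range contains the dense span of the characters. -/
theorem dense_range_vladimirovTest (hK : IsNormalizedAbs K) (hμ : μ (unitBall K) = 1)
    (hχ : IsRankZero χ) : DenseRange (vladimirovTest χ hχ μ) := by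
  refine (dense_span_charL2 hμ hχ).mono ?_
  rw [← LinearMap.coe_range, SetLike.coe_subset_coe, Submodule.span_le]
  rintro _ ⟨a, rfl⟩
  set φ : testO K := ⟨_, indicator_char_mem_testO hχ a⟩
  have hφ : testToL2 μ φ = charL2 hχ μ a := by
    refine MemLp.toLp_congr (memLp_unitBall (testO_continuous φ.2)) _ ?_
    filter_upwards [ae_restrict_mem measurableSet_closedBall] with x hx
    exact Set.indicator_of_mem hx fun x => (χ (a * x) : ℂ)
  have h1 : vladimirovTest χ hχ μ φ = (eigenvalue a : ℂ) • charL2 hχ μ a := by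
    refine eq_of_inner_charL2_eq hμ hχ fun b => ?_
    rw [inner_charL2_vladimirovTest hK hμ, hφ, inner_smul_right, inner_charL2_charL2 hK hμ]
    split_ifs with h
    · rw [eigenvalue_eq_of_norm_sub_le h]
    · simp
  refine ⟨(eigenvalue a : ℂ)⁻¹ • φ, ?_⟩
  rw [map_smul, h1, smul_smul, inv_mul_cancel₀, one_smul]
  exact_mod_cast (eigenvalue_pos hK a).ne'

theorem mem_graph_vladimirovOMin_iff (hχ : IsRankZero χ) {x y : L2O μ} :
    (x, y) ∈ (vladimirovOMin χ hχ μ).graph ↔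
      ∃ φ, testToL2 μ φ = x ∧ vladimirovTest χ hχ μ φ = y := by
  rw [LinearPMap.mem_graph_iff]
  have key : ∀ φ, vladimirovOMin χ hχ μ ⟨testToL2 μ φ, ⟨φ, rfl⟩⟩ = vladimirovTest χ hχ μ φ := by
    intro φ
    change vladimirovTest χ hχ μ ((LinearEquiv.ofInjective (testToL2 μ)
      (testToL2_injective μ)).symm (LinearEquiv.ofInjective (testToL2 μ)
      (testToL2_injective μ) φ)) = _
    rw [LinearEquiv.symm_apply_apply]
  constructor
  · rintro ⟨⟨_, φ, rfl⟩, rfl, rfl⟩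
    exact ⟨φ, rfl, (key φ).symm⟩
  · rintro ⟨φ, rfl, rfl⟩
    exact ⟨⟨_, φ, rfl⟩, rfl, key φ⟩

/-- Since `B` inverts the operator on test functions, the graph lies in the closed set $x=By$.
Conversely, $(By,y)$ is a limit of graph points because the range is dense and `B` is continuous. -/
theorem mem_closure_graph_vladimirovOMin_iff (hK : IsNormalizedAbs K)
    (hμ : μ (unitBall K) = 1) (hχ : IsRankZero χ) {B : L2O μ →L[ℂ] L2O μ}
    (hB : ∀ u, B u =ᵐ[μ.restrict (unitBall K)] solution u) {x y : L2O μ} :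
    (x, y) ∈ (vladimirovOMin χ hχ μ).graph.topologicalClosure ↔ x = B y := by
  have hinv : ∀ φ, B (vladimirovTest χ hχ μ φ) = testToL2 μ φ := fun φ => by
    refine eq_of_inner_charL2_eq hμ hχ fun a => ?_
    rw [inner_charL2_solution hK hμ hχ hB, inner_charL2_vladimirovTest hK hμ, ← mul_assoc,
      inv_mul_cancel₀, one_mul]
    exact_mod_cast (eigenvalue_pos hK a).ne'
  rw [← SetLike.mem_coe, Submodule.topologicalClosure_coe]
  constructor
  · intro h
    have hcl : IsClosed {p : L2O μ × L2O μ | p.1 = B p.2} :=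
      isClosed_eq continuous_fst (B.continuous.comp continuous_snd)
    refine closure_minimal ?_ hcl h
    rintro ⟨x, y⟩ hxy
    obtain ⟨φ, rfl, rfl⟩ := (mem_graph_vladimirovOMin_iff hχ).1 hxy
    exact (hinv φ).symm
  · rintro rfl
    refine map_mem_closure (f := fun y => (B y, y)) (B.continuous.prodMk continuous_id)
      (dense_range_vladimirovTest hK hμ hχ y) ?_
    rintro _ ⟨φ, rfl⟩
    exact (mem_graph_vladimirovOMin_iff hχ).2 ⟨φ, (hinv φ).symm, rfl⟩

/-- Closability amounts to injectivity of `B`: it multiplies each coefficient by a nonzero number,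
so $By=0$ forces all coefficients of $y$ to vanish. -/
theorem isClosable_vladimirovOMin (hK : IsNormalizedAbs K) (hμ : μ (unitBall K) = 1)
    (hχ : IsRankZero χ) : (vladimirovOMin χ hχ μ).IsClosable := by
  obtain ⟨B, hB⟩ := exists_solution_operator (μ := μ) hK hμ hχ
  refine ⟨(vladimirovOMin χ hχ μ).graph.topologicalClosure.toLinearPMap,
    (Submodule.toLinearPMap_graph_eq _ ?_).symm⟩
  rintro ⟨x, y⟩ hxy hx
  rw [mem_closure_graph_vladimirovOMin_iff hK hμ hχ hB] at hxy
  have hx' : x = 0 := hx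
  change y = 0
  refine eq_of_inner_charL2_eq hμ hχ fun a => ?_
  have h1 := inner_charL2_solution hK hμ hχ hB a y
  rw [← hxy, hx', inner_zero_right] at h1
  have h2 : (eigenvalue a : ℂ)⁻¹ ≠ 0 :=
    inv_ne_zero (by exact_mod_cast (eigenvalue_pos hK a).ne')
  rw [inner_zero_right]
  exact (mul_eq_zero.1 h1.symm).resolve_left h2

theorem mem_graph_vladimirovO_iff (hK : IsNormalizedAbs K)
    (hμ : μ (unitBall K) = 1) (hχ : IsRankZero χ) {B : L2O μ →L[ℂ] L2O μ}
    (hB : ∀ u, B u =ᵐ[μ.restrict (unitBall K)] solution u) {x y : L2O μ} :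
    (x, y) ∈ (vladimirovO χ hχ μ).graph ↔ x = B y := by
  rw [← mem_closure_graph_vladimirovOMin_iff hK hμ hχ hB,
    (isClosable_vladimirovOMin hK hμ hχ).graph_closure_eq_closure_graph]
  rfl

theorem ker_vladimirovO (hK : IsNormalizedAbs K) (hμ : μ (unitBall K) = 1) (hχ : IsRankZero χ) :
    LinearMap.ker (vladimirovO χ hχ μ).toFun = ⊥ := by
  obtain ⟨B, hB⟩ := exists_solution_operator (μ := μ) hK hμ hχ
  refine LinearMap.ker_eq_bot'.2 fun x hx => Subtype.ext ?_
  have h := (mem_graph_vladimirovO_iff hK hμ hχ hB).1 ((vladimirovO χ hχ μ).mem_graph x)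
  have hx' : vladimirovO χ hχ μ x = 0 := hx
  rw [h, hx', map_zero]
  rfl

theorem exists_inverse_vladimirovO_ae_eq (hK : IsNormalizedAbs K) (hμ : μ (unitBall K) = 1)
    (hχ : IsRankZero χ) (u : L2O μ) : ∃ hu : u ∈ (vladimirovO χ hχ μ).inverse.domain,
      (vladimirovO χ hχ μ).inverse ⟨u, hu⟩ =ᵐ[μ.restrict (unitBall K)] solution u := by
  obtain ⟨B, hB⟩ := exists_solution_operator (μ := μ) hK hμ hχ
  obtain ⟨x, hx, hxu⟩ := (LinearPMap.mem_graph_iff _).1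
    ((mem_graph_vladimirovO_iff hK hμ hχ hB).2 (rfl : B u = B u))
  refine ⟨by rw [LinearPMap.inverse_domain]; exact ⟨x, hxu⟩, ?_⟩
  rw [LinearPMap.inverse_apply_eq (ker_vladimirovO hK hμ hχ) (x := x) hxu, hx]
  exact hB u

end VladimirovOperator

/-! ### The regularized integral and its local form -/

section Representation

variable {K : Type*} [NontriviallyNormedField K] [IsUltrametricDist K]
  [LocallyCompactSpace K] [MeasurableSpace K] [BorelSpace K]
  {μ : Measure K} [μ.IsAddHaarMeasure] {χ : AddChar K Circle}

theorem integrableOn_log_norm_sub_mul (hK : IsNormalizedAbs K) (hμ : μ (unitBall K) = 1)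
    (u : L2O μ) {x : K} (hx : ‖x‖ ≤ 1) :
    IntegrableOn (fun y => (Real.log ‖x - y‖ : ℂ) * u y) (unitBall K) μ :=
  (memLp_log_norm_sub hK hμ hx).integrable_mul (Lp.memLp u)

theorem antiderivative_indicator (u : K → ℂ) (x : K) :
    antiderivative μ ((unitBall K).indicator u) x =
      antiConst K * ∫ y in unitBall K, (Real.log ‖x - y‖ : ℂ) * u y ∂μ := by
  rw [antiderivative, ← integral_indicator measurableSet_closedBall, antiConst]
  simp only [Set.indicator_mul_right]

theorem solution_eq (hK : IsNormalizedAbs K) (hμ : μ (unitBall K) = 1) (u : L2O μ) {x : K}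
    (hx : ‖x‖ ≤ 1) : solution u x =
      antiderivative μ ((unitBall K).indicator u) x + ∫ y in unitBall K, u y ∂μ := by
  have := isFiniteMeasure_unitBall (μ := μ)
  rw [antiderivative_indicator, solution, ← integral_const_mul,
    ← integral_add ((integrableOn_log_norm_sub_mul hK hμ u hx).const_mul _)
      ((Lp.memLp u).integrable (by simp))]
  simp only [add_mul, one_mul, mul_assoc]

/-- `solution u` differs from the antiderivative by the constant $\int_O u$, which cancels in the
difference. -/
theorem integralO_eq_solution_sub (hK : IsNormalizedAbs K) (hμ : μ (unitBall K) = 1) (u : L2O μ)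
    {x : K} (hx : ‖x‖ ≤ 1) : integralO μ u x = solution u x - solution u 0 := by
  rw [solution_eq hK hμ u hx, solution_eq hK hμ u (x := 0) (by simp), integralO,
    regularizedIntegral]
  ring

/-- When $|y|>|x|$ the ultrametric inequality gives $|x-y|=|y|$, so the two logarithms cancel
outside the ball of radius $|x|$. -/
theorem integralO_eq_integral_closedBall (hK : IsNormalizedAbs K) (hμ : μ (unitBall K) = 1)
    (u : L2O μ) {x : K} (hx : ‖x‖ ≤ 1) : integralO μ u x =
      antiConst K * ∫ y in closedBall (0 : K) ‖x‖,
        ((Real.log ‖x - y‖ - Real.log ‖y‖ : ℝ) : ℂ) * u y ∂μ := by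
  rw [integralO, regularizedIntegral, antiderivative_indicator, antiderivative_indicator,
    ← mul_sub, ← integral_sub (integrableOn_log_norm_sub_mul hK hμ u hx)
      (integrableOn_log_norm_sub_mul hK hμ u (by simp))]
  congr 1
  rw [← setIntegral_eq_of_subset_of_forall_sdiff_eq_zero measurableSet_closedBall
    (closedBall_subset_closedBall hx)]
  · refine integral_congr_ae (Filter.Eventually.of_forall fun y => ?_)
    simp only [zero_sub, norm_neg, ← sub_mul, Complex.ofReal_sub]
  · rintro y ⟨-, hy⟩
    have hxy : ‖x‖ < ‖y‖ := by simpa using hy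
    have h2 : ‖x - y‖ = ‖y‖ := by
      rw [sub_eq_add_neg, IsUltrametricDist.norm_add_eq_max_of_norm_ne_norm
        (by rw [norm_neg]; exact hxy.ne), norm_neg, max_eq_right hxy.le]
    simp [h2]

end Representation

end LocalFieldCalculus

end

theorem theorem1 {K : Type*} [NontriviallyNormedField K] [IsUltrametricDist K]
    [LocallyCompactSpace K] [MeasurableSpace K] [BorelSpace K]
    (hK : IsNormalizedAbs K)
    (μ : Measure K) [μ.IsAddHaarMeasure] (hμ : μ (unitBall K) = 1)
    (χ : AddChar K Circle) (hχ : IsRankZero χ) :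
    -- `D_O¹` is well defined as a closure, and it has an inverse defined on all of `L²(O)`
    (vladimirovOMin χ hχ μ).IsClosable ∧
    LinearMap.ker (vladimirovO χ hχ μ).toFun = ⊥ ∧
    ∀ u : L2O μ,
      ∃ hu : u ∈ (vladimirovO χ hχ μ).inverse.domain,
        -- `(D_O¹)⁻¹ u` has a continuous representative, and for each such representative `w`,
        (∃ w : K → ℂ, ContinuousOn w (unitBall K) ∧
          w =ᵐ[μ.restrict (unitBall K)]
            (vladimirovO χ hχ μ).inverse ⟨u, hu⟩) ∧
        ∀ w : K → ℂ, ContinuousOn w (unitBall K) →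
          w =ᵐ[μ.restrict (unitBall K)]
            (vladimirovO χ hχ μ).inverse ⟨u, hu⟩ →
          ∀ x ∈ unitBall K,
            -- the integral that defines `I_O¹ u` at `x` converges absolutely,
            IntegrableOn (fun y => (Real.log ‖x - y‖ : ℂ) * u y)
              (unitBall K) μ ∧
            -- it gives the explicit expression over the ball `|y| ≤ |x|`,
            integralO μ u x =
              (((1 - resCard K) / (resCard K *
                Real.log (resCard K)) : ℝ) : ℂ) *
                ∫ y in Metric.closedBall (0 : K) ‖x‖,
                  ((Real.log ‖x - y‖ - Real.log ‖y‖ : ℝ) : ℂ) * u y ∂μ ∧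
            -- and the local representation holds at `x`
            integralO μ u x = w x - w 0 := by
  refine ⟨isClosable_vladimirovOMin hK hμ hχ, ker_vladimirovO hK hμ hχ, fun u => ?_⟩
  obtain ⟨hu, hsol⟩ := exists_inverse_vladimirovO_ae_eq hK hμ hχ u
  have hcont := continuousOn_solution hK hμ hχ u
  refine ⟨hu, ⟨solution u, hcont, hsol.symm⟩, fun w hw hwu x hx => ?_⟩
  -- $O$ is open and Haar measure charges open sets, so continuous representatives that agree almost
  -- everywhere on $O$ agree at every point of it, including $x$ and $0$.
  have heq : Set.EqOn w (solution u) (unitBall K) := Measure.eqOn_open_of_ae_eq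
    (hwu.trans hsol) (IsUltrametricDist.isOpen_closedBall 0 one_ne_zero) hw hcont
  have hx' : ‖x‖ ≤ 1 := by simpa using hx
  refine ⟨integrableOn_log_norm_sub_mul hK hμ u hx', integralO_eq_integral_closedBall hK hμ u hx',
    ?_⟩
  rw [integralO_eq_solution_sub hK hμ u hx', heq hx, heq (mem_closedBall_self zero_le_one)]
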